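/- C*-algebras are complex and not necessarily unital, and $*$-homomorphisms need not preserve units. For a C*-algebra $A$ let $\widetilde A$ be its unitization with adjoined unit $\mathbb 1$, and order the C*-algebra $\mathbf M_2(\widetilde A)$ as usual ($X\le Y$ iff $Y-X$ is positive). Let $\varepsilon>0$. Then there is a universal C*-algebra $$P=C^*\left\langle h,k,x\ \middle|\ \|hk\|\le\varepsilon,\quad 0\le\begin{bmatrix}\mathbb 1-h & x^*\\ x & k\end{bmatrix}\le 1\right\rangle,$$ that is, a C*-algebra $P$ with elements $h,k,x$ that satisfy these relations (the second one in $\mathbf M_2(\widetilde P)$), such that for every C*-algebra $A$ and all $a,b,c\in A$ that satisfy them (with $h,k,x$ replaced by $a,b,c$) there is exactly one $*$-homomorphism $\varphi\colon P\to A$ with $\varphi(h)=a$, $\varphi(k)=b$, $\varphi(x)=c$. Moreover, any such $P$ is projective: for every surjective $*$-homomorphism $\rho\colon B\to C$ of C*-algebras and every $*$-homomorphism $\varphi\colon P\to C$ there is a $*$-homomorphism $\psi\colon P\to B$ with $\rho\circ\psi=\varphi$. -/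

import Mathlib

/-!
All C⋆-algebras are complex and possibly non-unital (`NonUnitalCStarAlgebra`), and morphisms are
⋆-homomorphisms `→⋆ₙₐ[ℂ]`, which need not preserve units.
-/

universe u v

namespace SoftQC

/-- The matrix `[[𝟙 - h, x⋆], [x, k]]` over the unitization of `A`, where `𝟙` is the unit that
is adjoined to `A`. -/
noncomputable def blockMatrix {A : Type u} [NonUnitalCStarAlgebra A] (h k x : A) :
    CStarMatrix (Fin 2) (Fin 2) (Unitization ℂ A) :=
  CStarMatrix.ofMatrix
    !![1 - (h : Unitization ℂ A), star (x : Unitization ℂ A);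
      (x : Unitization ℂ A), (k : Unitization ℂ A)]

/-- The relations `‖h k‖ ≤ ε` and `0 ≤ [[𝟙 - h, x⋆], [x, k]] ≤ 1` for elements `h, k, x` of a
C⋆-algebra `A`. The order is the usual order of the C⋆-algebra of `2 × 2` matrices over the
unitization of `A`. -/
def Relations (ε : ℝ) {A : Type u} [NonUnitalCStarAlgebra A] (h k x : A) : Prop :=
  -- the canonical order on `A`, from which Mathlib obtains the one on the matrices
  letI : PartialOrder A := CStarAlgebra.spectralOrder A
  haveI : StarOrderedRing A := CStarAlgebra.spectralOrderedRing A
  ‖h * k‖ ≤ ε ∧ 0 ≤ blockMatrix h k x ∧ blockMatrix h k x ≤ 1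

/-- `P` with generators `h, k, x` is the universal C⋆-algebra of the relations: its generators
satisfy them, and every triple in a C⋆-algebra `A` that satisfies them is the image of the
generators under exactly one ⋆-homomorphism `P → A`. -/
def IsUniversal (ε : ℝ) {P : Type v} [NonUnitalCStarAlgebra P] (h k x : P) : Prop :=
  Relations ε h k x ∧
    ∀ (A : Type u) [NonUnitalCStarAlgebra A] (a b c : A), Relations ε a b c →
      ∃! φ : P →⋆ₙₐ[ℂ] A, φ h = a ∧ φ k = b ∧ φ x = c

/-- `P` is projective: whenever `ρ : B → C` is a surjective ⋆-homomorphism of C⋆-algebras, every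
⋆-homomorphism `P → C` factors as `ρ ∘ ψ` for a ⋆-homomorphism `ψ : P → B`. -/
def IsProjective (P : Type v) [NonUnitalCStarAlgebra P] : Prop :=
  ∀ (B C : Type u) [NonUnitalCStarAlgebra B] [NonUnitalCStarAlgebra C] (ρ : B →⋆ₙₐ[ℂ] C),
    Function.Surjective ρ → ∀ φ : P →⋆ₙₐ[ℂ] C, ∃ ψ : P →⋆ₙₐ[ℂ] B, ρ.comp ψ = φ

end SoftQC

/-! Projectivity reduces to lifting a triple with the relations along a surjection `ρ : B → C`,
since the universal property turns the lifted triple into `ψ` and its uniqueness part gives `ρ ∘ ψ =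
φ`.

The matrix inequality lifts by functional calculus: lift `h`, `k` to self-adjoint elements, form the
block matrix, and clamp its spectrum to `[0, 1]`. Clamping commutes with ⋆-homomorphisms, so images
that already satisfy the inequality do not change, and neither do the scalar parts of the entries
(`exists_contractive_map_eq`). The inequality survives compression of all entries by a self-adjoint
contraction `f` of the unitization (`Contractive.compress`).

The norm bound is the hard point. If `‖h k‖ ≤ ε + δ`, compress by `f = 1 - t u`, with `u` in the
kernel of `ρ`, almost commuting with `h` and `k`, and almost a unit for a `w` in the kernel that
captures the part of `h k` exceeding `ε`. Then `f h f * f k f ≈ f ^ 4 * h k`: near `w` the product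
is scaled by `(1 - t) ^ 4`, and away from `w` it was small already. High powers of `star z * z`
combine the two estimates into a bound close to their maximum
(`eventually_norm_compressed_product_lt`). With `t = O(δ)` the excess is halved at a cost `O(δ)` in
norm (`exists_contractive_halve_excess`); iteration converges to an exact lift
(`exists_relations_lift`).

For existence, a C⋆-algebra generated by three elements is separable and so injects as a set into `ℕ
→ ℝ`. The triples carried by subsets of that set form a small family; their coordinatewise
generators in the bounded product generate the universal algebra. -/

namespace SoftQC

open scoped CStarAlgebra ENNReal
open Filter Topology

/-! ### Clamping the spectrum to the unit interval -/

section Clamp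

/-- The retraction of the real line onto the unit interval. -/
noncomputable def clamp (t : ℝ) : ℝ := max 0 (min 1 t)

lemma continuous_clamp : Continuous clamp := by
  unfold clamp; fun_prop

lemma clamp_nonneg (t : ℝ) : 0 ≤ clamp t := le_max_left _ _

lemma clamp_le_one (t : ℝ) : clamp t ≤ 1 := by simp [clamp]

lemma clamp_eq_self {t : ℝ} (h₀ : 0 ≤ t) (h₁ : t ≤ 1) : clamp t = t := by
  simp [clamp, h₀, h₁]

variable {E : Type*} [CStarAlgebra E] [PartialOrder E] [StarOrderedRing E]

/-- The self-adjoint element `a`, cut down to the unit interval by functional calculus. -/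
noncomputable def cutDown {E : Type*} [CStarAlgebra E] (a : E) : E := cfc clamp a

lemma cutDown_eq_self {a : E} (h₀ : 0 ≤ a) (h₁ : a ≤ 1) : cutDown a = a := by
  have ha : IsSelfAdjoint a := h₀.isSelfAdjoint
  conv_rhs => rw [← cfc_id' ℝ a]
  refine cfc_congr fun t ht => ?_
  refine clamp_eq_self (spectrum_nonneg_of_nonneg (A := E) h₀ ht) ?_
  have := (CFC.le_one_iff (R := ℝ) a).mp h₁
  exact this t ht

lemma cutDown_nonneg (a : E) : 0 ≤ cutDown a :=
  cfc_nonneg fun t _ => clamp_nonneg t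

lemma cutDown_le_one (a : E) : cutDown a ≤ 1 :=
  cfc_le_one _ _ fun t _ => clamp_le_one t

lemma map_cutDown {E F : Type*} [CStarAlgebra E] [CStarAlgebra F] (φ : E →⋆ₐ[ℂ] F) {a : E}
    (ha : IsSelfAdjoint a) : φ (cutDown a) = cutDown (φ a) :=
  StarAlgHomClass.map_cfc (S := ℂ) φ clamp a continuous_clamp.continuousOn (by fun_prop) ha
    (ha.map φ)

end Clamp

/-- The condition `0 ≤ [[𝟙 - h, x⋆], [x, k]] ≤ 1`. -/
def Contractive {A : Type*} [NonUnitalCStarAlgebra A] (h k x : A) : Prop :=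
  letI : PartialOrder A := CStarAlgebra.spectralOrder A
  haveI : StarOrderedRing A := CStarAlgebra.spectralOrderedRing A
  0 ≤ blockMatrix h k x ∧ blockMatrix h k x ≤ 1

lemma relations_iff {ε : ℝ} {A : Type*} [NonUnitalCStarAlgebra A] {h k x : A} :
    Relations ε h k x ↔ ‖h * k‖ ≤ ε ∧ Contractive h k x := Iff.rfl

/-- The `2 × 2` matrices over the unitization of `A`. -/
abbrev Mat (A : Type*) [NonUnitalCStarAlgebra A] : Type _ :=
  CStarMatrix (Fin 2) (Fin 2) (Unitization ℂ A)

/-! ### Functoriality of the block matrix -/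

section Map

variable {A B : Type*} [NonUnitalCStarAlgebra A] [NonUnitalCStarAlgebra B]

/-- The unital ⋆-homomorphism that `φ` induces on `2 × 2` matrices over the unitizations. -/
noncomputable def matMap (φ : A →⋆ₙₐ[ℂ] B) : Mat A →⋆ₐ[ℂ] Mat B where
  toFun M := M.map (Unitization.starMap φ)
  map_one' := by
    refine CStarMatrix.ext fun i j => ?_
    rw [CStarMatrix.map_apply, CStarMatrix.one_apply, CStarMatrix.one_apply]
    split <;> simp
  map_mul' M N := by
    refine CStarMatrix.ext fun i j => ?_
    simp only [CStarMatrix.map_apply, CStarMatrix.mul_apply, map_sum, map_mul]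
  map_zero' := by
    refine CStarMatrix.ext fun i j => ?_
    rw [CStarMatrix.map_apply, CStarMatrix.zero_apply, CStarMatrix.zero_apply, map_zero]
  map_add' M N := by
    refine CStarMatrix.ext fun i j => ?_
    simp only [CStarMatrix.map_apply, CStarMatrix.add_apply, map_add]
  commutes' r := by
    refine CStarMatrix.ext fun i j => ?_
    rw [CStarMatrix.map_apply, CStarMatrix.algebraMap_apply, CStarMatrix.algebraMap_apply]
    split
    · exact AlgHomClass.commutes _ r
    · simp
  map_star' M := by
    refine CStarMatrix.ext fun i j => ?_
    simp only [CStarMatrix.map_apply, CStarMatrix.star_apply, map_star]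

lemma matMap_apply (φ : A →⋆ₙₐ[ℂ] B) (M : Mat A) (i j : Fin 2) :
    matMap φ M i j = Unitization.starMap φ (M i j) := rfl

lemma blockMatrix_zero_zero (h k x : A) :
    blockMatrix h k x 0 0 = 1 - (h : Unitization ℂ A) := rfl

lemma blockMatrix_zero_one (h k x : A) :
    blockMatrix h k x 0 1 = star (x : Unitization ℂ A) := rfl

lemma blockMatrix_one_zero (h k x : A) :
    blockMatrix h k x 1 0 = (x : Unitization ℂ A) := rfl

lemma blockMatrix_one_one (h k x : A) :
    blockMatrix h k x 1 1 = (k : Unitization ℂ A) := rfl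

lemma mat_ext {M N : Mat A} (h₀₀ : M 0 0 = N 0 0) (h₀₁ : M 0 1 = N 0 1) (h₁₀ : M 1 0 = N 1 0)
    (h₁₁ : M 1 1 = N 1 1) : M = N := by
  refine CStarMatrix.ext fun i j => ?_
  fin_cases i <;> fin_cases j <;> assumption

lemma matMap_blockMatrix (φ : A →⋆ₙₐ[ℂ] B) (h k x : A) :
    matMap φ (blockMatrix h k x) = blockMatrix (φ h) (φ k) (φ x) := by
  apply mat_ext
  · rw [matMap_apply, blockMatrix_zero_zero, blockMatrix_zero_zero, map_sub, map_one,
      Unitization.starMap_inr]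
  · rw [matMap_apply, blockMatrix_zero_one, blockMatrix_zero_one, map_star,
      Unitization.starMap_inr]
  · rw [matMap_apply, blockMatrix_one_zero, blockMatrix_one_zero, Unitization.starMap_inr]
  · rw [matMap_apply, blockMatrix_one_one, blockMatrix_one_one, Unitization.starMap_inr]

lemma blockMatrix_injective {h k x h' k' x' : A} (H : blockMatrix h k x = blockMatrix h' k' x') :
    h = h' ∧ k = k' ∧ x = x' := by
  refine ⟨?_, ?_, ?_⟩
  · have := congrArg (fun M : Mat A => M 0 0) H
    exact Unitization.inr_injective (sub_right_injective this)
  · exact Unitization.inr_injective (congrArg (fun M : Mat A => M 1 1) H)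
  · exact Unitization.inr_injective (congrArg (fun M : Mat A => M 1 0) H)

lemma isSelfAdjoint_blockMatrix_iff {h k x : A} :
    IsSelfAdjoint (blockMatrix h k x) ↔ IsSelfAdjoint h ∧ IsSelfAdjoint k := by
  constructor
  · intro H
    refine ⟨?_, ?_⟩
    · have := congrArg (fun M : Mat A => M 0 0) H
      have h2 : star (1 - (h : Unitization ℂ A)) = 1 - (h : Unitization ℂ A) := this
      rw [star_sub, star_one, ← Unitization.inr_star] at h2
      exact Unitization.inr_injective (sub_right_injective h2)
    · have := congrArg (fun M : Mat A => M 1 1) H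
      have h2 : star (k : Unitization ℂ A) = (k : Unitization ℂ A) := this
      rw [← Unitization.inr_star] at h2
      exact Unitization.inr_injective h2
  · rintro ⟨hh, hk⟩
    apply mat_ext
    · rw [CStarMatrix.star_apply, blockMatrix_zero_zero, star_sub, star_one,
        ← Unitization.inr_star, hh.star_eq]
    · rw [CStarMatrix.star_apply, blockMatrix_zero_one, blockMatrix_one_zero]
    · rw [CStarMatrix.star_apply, blockMatrix_zero_one, blockMatrix_one_zero, star_star]
    · rw [CStarMatrix.star_apply, blockMatrix_one_one, ← Unitization.inr_star, hk.star_eq]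

end Map

/-! ### Lifting and compressing the matrix inequality -/

section Contractive

variable {A B : Type*} [NonUnitalCStarAlgebra A] [NonUnitalCStarAlgebra B]

lemma Contractive.map {h k x : A} (H : Contractive h k x) (φ : A →⋆ₙₐ[ℂ] B) :
    Contractive (φ h) (φ k) (φ x) := by
  let _ : PartialOrder A := CStarAlgebra.spectralOrder A
  have _ : StarOrderedRing A := CStarAlgebra.spectralOrderedRing A
  let _ : PartialOrder B := CStarAlgebra.spectralOrder B
  have _ : StarOrderedRing B := CStarAlgebra.spectralOrderedRing B
  obtain ⟨h₀, h₁⟩ := H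
  have m₀ := map_nonneg (matMap φ) h₀
  have m₁ := map_nonneg (matMap φ) (sub_nonneg.mpr h₁)
  rw [map_sub, map_one, sub_nonneg] at m₁
  rw [matMap_blockMatrix] at m₀ m₁
  exact ⟨m₀, m₁⟩

lemma Contractive.isSelfAdjoint {h k x : A} (H : Contractive h k x) :
    IsSelfAdjoint h ∧ IsSelfAdjoint k := by
  let _ : PartialOrder A := CStarAlgebra.spectralOrder A
  have _ : StarOrderedRing A := CStarAlgebra.spectralOrderedRing A
  exact isSelfAdjoint_blockMatrix_iff.mp H.1.isSelfAdjoint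

lemma Contractive.norm_le_one {h k x : A} (H : Contractive h k x) :
    ‖h‖ ≤ 1 ∧ ‖k‖ ≤ 1 ∧ ‖x‖ ≤ 1 := by
  let _ : PartialOrder A := CStarAlgebra.spectralOrder A
  have _ : StarOrderedRing A := CStarAlgebra.spectralOrderedRing A
  obtain ⟨h₀, h₁⟩ := H
  have n₁ : ‖blockMatrix h k x‖ ≤ 1 := (CStarAlgebra.norm_le_one_iff_of_nonneg _ h₀).mpr h₁
  have n₂ : ‖1 - blockMatrix h k x‖ ≤ 1 :=
    (CStarAlgebra.norm_le_one_iff_of_nonneg _ (sub_nonneg.mpr h₁)).mpr (sub_le_self _ h₀)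
  refine ⟨?_, ?_, ?_⟩
  · have := (CStarMatrix.norm_entry_le_norm (M := 1 - blockMatrix h k x) (i := 0) (j := 0)).trans n₂
    rwa [CStarMatrix.sub_apply, blockMatrix_zero_zero, CStarMatrix.one_apply_eq, sub_sub_cancel,
      Unitization.norm_inr] at this
  · have := (CStarMatrix.norm_entry_le_norm (M := blockMatrix h k x) (i := 1) (j := 1)).trans n₁
    rwa [blockMatrix_one_one, Unitization.norm_inr] at this
  · have := (CStarMatrix.norm_entry_le_norm (M := blockMatrix h k x) (i := 1) (j := 0)).trans n₁
    rwa [blockMatrix_one_zero, Unitization.norm_inr] at this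

lemma continuous_blockMatrix :
    Continuous fun p : A × A × A => blockMatrix p.1 p.2.1 p.2.2 := by
  have hi : Continuous fun a : A => (a : Unitization ℂ A) := (Unitization.isometry_inr).continuous
  have H : ∀ i j, Continuous fun p : A × A × A => blockMatrix p.1 p.2.1 p.2.2 i j := by
    intro i j
    fin_cases i <;> fin_cases j
    · exact continuous_const.sub (hi.comp continuous_fst)
    · exact (hi.comp (continuous_snd.comp continuous_snd)).star
    · exact hi.comp (continuous_snd.comp continuous_snd)
    · exact hi.comp (continuous_fst.comp continuous_snd)
  exact (CStarMatrix.ofMatrixL (m := Fin 2) (n := Fin 2) (A := Unitization ℂ A)).continuous.comp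
    (continuous_matrix (f := fun p : A × A × A => CStarMatrix.ofMatrix.symm
      (blockMatrix p.1 p.2.1 p.2.2)) H)

lemma Contractive.of_tendsto {ι : Type*} {l : Filter ι} [l.NeBot] {h k x : ι → A} {h' k' x' : A}
    (hh : Tendsto h l (𝓝 h')) (hk : Tendsto k l (𝓝 k')) (hx : Tendsto x l (𝓝 x'))
    (H : ∀ i, Contractive (h i) (k i) (x i)) : Contractive h' k' x' := by
  let _ : PartialOrder A := CStarAlgebra.spectralOrder A
  have _ : StarOrderedRing A := CStarAlgebra.spectralOrderedRing A
  have hp : Tendsto (fun i => (h i, k i, x i)) l (𝓝 (h', k', x')) :=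
    hh.prodMk_nhds (hk.prodMk_nhds hx)
  have hc := (continuous_blockMatrix (A := A)).tendsto (h', k', x')
  have ht := Filter.Tendsto.comp hc hp
  have h₀ := ge_of_tendsto' (b := (0 : Mat A)) ht fun i => (H i).1
  have h₁ := le_of_tendsto' (b := (1 : Mat A)) ht fun i => (H i).2
  exact ⟨h₀, h₁⟩

/-- The matrix is the projection `diag(1, 0)`. Clamping therefore fixes it, which later determines
the scalar parts of a clamped block matrix. -/
lemma contractive_zero : Contractive (0 : A) 0 0 := by
  let _ : PartialOrder A := CStarAlgebra.spectralOrder A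
  have _ : StarOrderedRing A := CStarAlgebra.spectralOrderedRing A
  have hsa : star (blockMatrix (0 : A) 0 0) = blockMatrix (0 : A) 0 0 :=
    isSelfAdjoint_blockMatrix_iff.mpr ⟨.zero A, .zero A⟩
  have hid : blockMatrix (0 : A) 0 0 * blockMatrix (0 : A) 0 0 = blockMatrix (0 : A) 0 0 := by
    apply mat_ext <;>
    simp [CStarMatrix.mul_apply, blockMatrix_zero_zero, blockMatrix_zero_one,
      blockMatrix_one_zero, blockMatrix_one_one]
  have h₀ : 0 ≤ blockMatrix (0 : A) 0 0 := by
    rw [← hid]; nth_rw 1 [← hsa]; exact star_mul_self_nonneg _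
  refine ⟨h₀, ?_⟩
  rw [← sub_nonneg]
  have : 1 - blockMatrix (0 : A) 0 0 =
      star (1 - blockMatrix (0 : A) 0 0) * (1 - blockMatrix (0 : A) 0 0) := by
    rw [star_sub, star_one, hsa, sub_mul, mul_sub, mul_sub, hid]; simp
  rw [this]; exact star_mul_self_nonneg _

lemma matMap_cutDown_blockMatrix (φ : A →⋆ₙₐ[ℂ] B) {h k x : A} (hh : IsSelfAdjoint h)
    (hk : IsSelfAdjoint k) (H : Contractive (φ h) (φ k) (φ x)) :
    let _ : PartialOrder A := CStarAlgebra.spectralOrder A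
    have _ : StarOrderedRing A := CStarAlgebra.spectralOrderedRing A
    matMap φ (cutDown (blockMatrix h k x)) = blockMatrix (φ h) (φ k) (φ x) := by
  intro _ _
  let _ : PartialOrder B := CStarAlgebra.spectralOrder B
  have _ : StarOrderedRing B := CStarAlgebra.spectralOrderedRing B
  have := map_cutDown (matMap φ) (isSelfAdjoint_blockMatrix_iff.mpr ⟨hh, hk⟩ :
    IsSelfAdjoint (blockMatrix h k x))
  rw [this, matMap_blockMatrix, cutDown_eq_self H.1 H.2]

/-- The zero homomorphism induces the projection of the unitization onto its scalars, so scalar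
parts can be followed through the functional calculus like any other homomorphic image. -/
lemma fst_starMap_zero (z : Unitization ℂ A) :
    (Unitization.starMap (0 : A →⋆ₙₐ[ℂ] A) z).fst = z.fst := by
  induction z using Unitization.ind with
  | inl_add_inr r a =>
    rw [map_add, Unitization.starMap_inr, Unitization.starMap_inl, Unitization.algebraMap_eq_inl]
    simp

/-- Scalar parts equal to those of `diag(1, 0)` put all entries, up to the unit in the corner,
inside `A`; self-adjointness ties the two off-diagonal entries together. -/
lemma eq_blockMatrix {N : Mat A} (hN : IsSelfAdjoint N)
    (hfst : ∀ i j, (N i j).fst = (blockMatrix (0 : A) 0 0 i j).fst) :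
    N = blockMatrix (-(N 0 0).snd) (N 1 1).snd (N 1 0).snd := by
  have h10 : N 1 0 = ((N 1 0).snd : Unitization ℂ A) :=
    Unitization.ext (by rw [hfst, blockMatrix_one_zero]; simp) (by simp)
  apply mat_ext
  · rw [blockMatrix_zero_zero]
    refine Unitization.ext ?_ ?_
    · rw [hfst, blockMatrix_zero_zero]; simp
    · simp
  · rw [blockMatrix_zero_one, ← h10, ← CStarMatrix.star_apply, hN.star_eq]
  · rw [blockMatrix_one_zero, ← h10]
  · rw [blockMatrix_one_one]
    exact Unitization.ext (by rw [hfst, blockMatrix_one_one]; simp) (by simp)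

/-- Cutting the block matrix down to the unit interval by functional calculus produces a triple
that satisfies the matrix inequality and has the same image as the given triple under every
⋆-homomorphism whose image triple satisfies it already. -/
lemma exists_contractive_map_eq {h k : A} (x : A) (hh : IsSelfAdjoint h) (hk : IsSelfAdjoint k) :
    ∃ h' k' x' : A, Contractive h' k' x' ∧
      ∀ (B : Type v) [NonUnitalCStarAlgebra B] (φ : A →⋆ₙₐ[ℂ] B),
        Contractive (φ h) (φ k) (φ x) → φ h' = φ h ∧ φ k' = φ k ∧ φ x' = φ x := by
  let _ : PartialOrder A := CStarAlgebra.spectralOrder A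
  have _ : StarOrderedRing A := CStarAlgebra.spectralOrderedRing A
  have hN₀ := cutDown_nonneg (blockMatrix h k x)
  have hN₁ := cutDown_le_one (blockMatrix h k x)
  have hfst : ∀ i j, (cutDown (blockMatrix h k x) i j).fst =
      (blockMatrix (0 : A) 0 0 i j).fst := by
    intro i j
    have := matMap_cutDown_blockMatrix (0 : A →⋆ₙₐ[ℂ] A) (x := x) hh hk contractive_zero
    rw [← fst_starMap_zero, ← matMap_apply, this]
    rfl
  have hN := eq_blockMatrix hN₀.isSelfAdjoint hfst
  have key : ∀ (B : Type v) [NonUnitalCStarAlgebra B] (φ : A →⋆ₙₐ[ℂ] B),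
      Contractive (φ h) (φ k) (φ x) →
        matMap φ (cutDown (blockMatrix h k x)) = blockMatrix (φ h) (φ k) (φ x) :=
    fun B _ φ H => matMap_cutDown_blockMatrix φ hh hk H
  generalize cutDown (blockMatrix h k x) = N at hN₀ hN₁ hN key
  rw [hN] at hN₀ hN₁
  refine ⟨_, _, _, ⟨hN₀, hN₁⟩, fun B _ φ H => ?_⟩
  have := key B φ H
  rw [hN, matMap_blockMatrix] at this
  exact blockMatrix_injective this

/-- Conjugating by `diag(f, f)` turns the corner `1 - h` into `f * f - f * h * f`. The missing `1 -
f * f` is positive because `f` is a self-adjoint contraction. For the upper bound the same defect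
appears in the other corner. -/
lemma Contractive.compress {h k x h' k' x' : A} (H : Contractive h k x) {f : Unitization ℂ A}
    (hf : IsSelfAdjoint f) (hf₁ : ‖f‖ ≤ 1) (hh : (h' : Unitization ℂ A) = f * h * f)
    (hk : (k' : Unitization ℂ A) = f * k * f) (hx : (x' : Unitization ℂ A) = f * x * f) :
    Contractive h' k' x' := by
  let _ : PartialOrder A := CStarAlgebra.spectralOrder A
  have _ : StarOrderedRing A := CStarAlgebra.spectralOrderedRing A
  have hff : 0 ≤ 1 - f * f := by
    have h₀ : 0 ≤ f * f := by
      nth_rw 1 [← hf.star_eq]; exact star_mul_self_nonneg f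
    rw [sub_nonneg, ← CStarAlgebra.norm_le_one_iff_of_nonneg _ h₀]
    exact (norm_mul_le _ _).trans (mul_le_one₀ hf₁ (norm_nonneg _) hf₁)
  obtain ⟨s, hs⟩ := CStarAlgebra.nonneg_iff_eq_star_mul_self.mp hff
  let diag (p q : Unitization ℂ A) : Mat A := CStarMatrix.ofMatrix !![p, 0; 0, q]
  have hD : star (diag f f) = diag f f := by
    apply mat_ext <;> simp [CStarMatrix.star_apply, diag, hf.star_eq]
  have d₁ : 0 ≤ diag (1 - f * f) 0 := by
    have : diag (1 - f * f) 0 = star (diag s 0) * diag s 0 := by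
      rw [hs]; apply mat_ext <;> simp [CStarMatrix.star_apply, CStarMatrix.mul_apply, diag]
    rw [this]; exact star_mul_self_nonneg _
  have d₂ : 0 ≤ diag 0 (1 - f * f) := by
    have : diag 0 (1 - f * f) = star (diag 0 s) * diag 0 s := by
      rw [hs]; apply mat_ext <;> simp [CStarMatrix.star_apply, CStarMatrix.mul_apply, diag]
    rw [this]; exact star_mul_self_nonneg _
  have e₁ : blockMatrix h' k' x' =
      star (diag f f) * blockMatrix h k x * diag f f + diag (1 - f * f) 0 := by
    have hx' : star (x' : Unitization ℂ A) = f * star (x : Unitization ℂ A) * f := by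
      rw [hx, star_mul, star_mul, hf.star_eq, mul_assoc]
    rw [hD]
    apply mat_ext
    · simp [CStarMatrix.mul_apply, blockMatrix_zero_zero, diag, hh]; noncomm_ring
    · simp [CStarMatrix.mul_apply, blockMatrix_zero_one, diag, hx']
    · simp [CStarMatrix.mul_apply, blockMatrix_one_zero, diag, hx]
    · simp [CStarMatrix.mul_apply, blockMatrix_one_one, diag, hk]
  have e₂ : 1 - blockMatrix h' k' x' =
      star (diag f f) * (1 - blockMatrix h k x) * diag f f + diag 0 (1 - f * f) := by
    have : star (diag f f) * (1 - blockMatrix h k x) * diag f f = diag (f * f) (f * f) -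
        star (diag f f) * blockMatrix h k x * diag f f := by
      rw [mul_sub, sub_mul, mul_one, hD]
      congr 1
      apply mat_ext <;> simp [CStarMatrix.mul_apply, diag]
    rw [e₁, this]
    have h1 : (1 : Mat A) = diag (1 - f * f) 0 + diag 0 (1 - f * f) + diag (f * f) (f * f) := by
      apply mat_ext <;> simp [diag]
    rw [h1]; abel
  refine ⟨?_, ?_⟩
  · rw [e₁]; exact add_nonneg (star_left_conjugate_nonneg H.1 _) d₁
  · rw [← sub_nonneg, e₂]
    exact add_nonneg (star_left_conjugate_nonneg (sub_nonneg.mpr H.2) _) d₂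

end Contractive

/-! ### Quasicentral approximate units of a kernel -/

section Cutoff

variable {B C : Type*} [NonUnitalCStarAlgebra B] [NonUnitalCStarAlgebra C]

/-- A self-adjoint contraction in the kernel of `ρ` whose complement in the unitization is a
contraction as well. -/
structure IsCutoff (ρ : B →⋆ₙₐ[ℂ] C) (u : B) : Prop where
  isSelfAdjoint : IsSelfAdjoint u
  map_eq_zero : ρ u = 0
  norm_le : ‖u‖ ≤ 1
  norm_one_sub_le : ‖1 - (u : Unitization ℂ B)‖ ≤ 1

lemma norm_one_sub_le_one_of_nonneg [PartialOrder B] [StarOrderedRing B] {u : B} (h₀ : 0 ≤ u)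
    (h₁ : ‖u‖ ≤ 1) : ‖1 - (u : Unitization ℂ B)‖ ≤ 1 := by
  have h₀' : 0 ≤ (u : Unitization ℂ B) := Unitization.inr_nonneg_iff.mpr h₀
  have h₁' : (u : Unitization ℂ B) ≤ 1 := by
    rwa [← CStarAlgebra.norm_le_one_iff_of_nonneg _ h₀', Unitization.norm_inr]
  exact (CStarAlgebra.norm_le_one_iff_of_nonneg _ (sub_nonneg.mpr h₁')).mpr (sub_le_self _ h₀')

/-- The kernel is closed, hence a C⋆-algebra with an approximate unit of its own; a late enough
element of it serves finitely many `a` at once. -/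
lemma exists_isCutoff_norm_mul_sub_lt (ρ : B →⋆ₙₐ[ℂ] C) (T : Finset B) (hT : ∀ a ∈ T, ρ a = 0)
    {η : ℝ} (hη : 0 < η) : ∃ u, IsCutoff ρ u ∧ ∀ a ∈ T, ‖a * u - a‖ < η := by
  let I : NonUnitalStarSubalgebra ℂ B := NonUnitalStarAlgHom.equalizer ρ 0
  have hI : ∀ b, b ∈ I ↔ ρ b = 0 := fun b => Iff.rfl
  have hcl : IsClosed (I : Set B) := by
    have : (I : Set B) = ρ ⁻¹' {0} := by ext b; exact hI b
    rw [this]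
    exact isClosed_singleton.preimage (map_continuous ρ)
  let _ : NonUnitalCStarAlgebra I := NonUnitalStarSubalgebra.nonUnitalCStarAlgebra I
  let _ : PartialOrder I := CStarAlgebra.spectralOrder I
  have _ : StarOrderedRing I := CStarAlgebra.spectralOrderedRing I
  let _ : PartialOrder B := CStarAlgebra.spectralOrder B
  have _ : StarOrderedRing B := CStarAlgebra.spectralOrderedRing B
  have hau := CStarAlgebra.increasingApproximateUnit I
  have hT' : ∀ᶠ x : I in CStarAlgebra.approximateUnit I, ∀ a ∈ T, ‖a * (x : B) - a‖ < η := by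
    rw [Filter.eventually_all_finset]
    intro a ha
    have := hau.tendsto_mul_left ⟨a, hT a ha⟩
    filter_upwards [(Metric.tendsto_nhds.mp this) η hη] with x hx
    rw [dist_eq_norm] at hx
    exact hx
  obtain ⟨x, hx, hx₀, hx₁⟩ := (hT'.and (hau.eventually_nonneg.and hau.eventually_norm)).exists
  have hx₀' : 0 ≤ (x : B) := by
    obtain ⟨y, hy⟩ := CStarAlgebra.nonneg_iff_eq_star_mul_self.mp hx₀
    have : (x : B) = star (y : B) * (y : B) := congrArg Subtype.val hy
    rw [this]; exact star_mul_self_nonneg _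
  exact ⟨x, ⟨hx₀'.isSelfAdjoint, x.2, hx₁, norm_one_sub_le_one_of_nonneg hx₀' hx₁⟩, hx⟩

/-- Every condition defining a cutoff is preserved by convex combinations. -/
lemma IsCutoff.average {ρ : B →⋆ₙₐ[ℂ] C} {N : ℕ} (hN : 0 < N) {u : ℕ → B}
    (hu : ∀ i, IsCutoff ρ (u i)) :
    IsCutoff ρ ((N : ℂ)⁻¹ • ∑ i ∈ Finset.range N, u i) := by
  have hN' : (N : ℂ) ≠ 0 := by exact_mod_cast hN.ne'
  have hNr : (N : ℝ)⁻¹ * N = 1 := inv_mul_cancel₀ (by exact_mod_cast hN.ne')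
  have hn : ‖(N : ℂ)⁻¹‖ = (N : ℝ)⁻¹ := by simp
  refine ⟨?_, ?_, ?_, ?_⟩
  · have h₁ : IsSelfAdjoint ((N : ℂ)⁻¹) := by simp [isSelfAdjoint_iff]
    have h₂ : IsSelfAdjoint (∑ i ∈ Finset.range N, u i) := by
      simp [isSelfAdjoint_iff, star_sum, (hu _).isSelfAdjoint.star_eq]
    exact h₁.smul h₂
  · simp [(hu _).map_eq_zero]
  · rw [norm_smul, hn]
    calc (N : ℝ)⁻¹ * ‖∑ i ∈ Finset.range N, u i‖ ≤ (N : ℝ)⁻¹ * ∑ i ∈ Finset.range N, 1 := by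
          gcongr
          exact norm_sum_le_of_le _ fun i _ => (hu i).norm_le
      _ = 1 := by simpa using hNr
  · have : 1 - (((N : ℂ)⁻¹ • ∑ i ∈ Finset.range N, u i : B) : Unitization ℂ B) =
        (N : ℂ)⁻¹ • ∑ i ∈ Finset.range N, (1 - (u i : Unitization ℂ B)) := by
      rw [Finset.sum_sub_distrib, smul_sub, Unitization.inr_smul]
      congr 1
      · rw [Finset.sum_const, Finset.card_range, ← Nat.cast_smul_eq_nsmul ℂ, smul_smul,
          inv_mul_cancel₀ hN', one_smul]
      · congr 1
        exact map_sum (Unitization.inrNonUnitalAlgHom ℂ B) _ _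
    rw [this, norm_smul, hn]
    calc _ ≤ (N : ℝ)⁻¹ * ∑ i ∈ Finset.range N, 1 := by
          gcongr
          exact norm_sum_le_of_le _ fun i _ => (hu i).norm_one_sub_le
      _ = 1 := by simpa using hNr

/-- A sum of skew-adjoint elements with small mutual products is small compared with the number
of summands. -/
lemma norm_sum_sq_le {N : ℕ} {c : ℕ → B} {K δ : ℝ} (hc : ∀ i, star (c i) = -c i)
    (hK : ∀ i, ‖c i‖ ≤ K) (hδ : 0 ≤ δ) (h : ∀ i j, i < j → ‖c i * c j‖ ≤ δ) :
    ‖∑ i ∈ Finset.range N, c i‖ ^ 2 ≤ N * K ^ 2 + N ^ 2 * δ := by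
  have hK₀ : 0 ≤ K := (norm_nonneg _).trans (hK 0)
  have h' : ∀ i j, ‖c i * c j‖ ≤ (if i = j then K ^ 2 else 0) + δ := by
    intro i j
    rcases lt_trichotomy i j with hij | rfl | hij
    · simpa [hij.ne] using h i j hij
    · rw [if_pos rfl, sq]
      exact (norm_mul_le _ _).trans ((mul_le_mul (hK i) (hK i) (norm_nonneg _) hK₀).trans
        (le_add_of_nonneg_right hδ))
    -- The products in the opposite order are adjoints of those already bounded.
    · have := h j i hij
      rw [← norm_star, star_mul, hc, hc, neg_mul_neg] at this
      simpa [hij.ne'] using this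
  have hs : star (∑ i ∈ Finset.range N, c i) = -∑ i ∈ Finset.range N, c i := by
    simp [hc]
  rw [sq, ← CStarRing.norm_star_mul_self, hs, neg_mul, norm_neg, Finset.sum_mul_sum]
  calc _ ≤ ∑ i ∈ Finset.range N, ∑ j ∈ Finset.range N, ((if i = j then K ^ 2 else 0) + δ) :=
        norm_sum_le_of_le _ fun i _ => norm_sum_le_of_le _ fun j _ => h' i j
    _ = ∑ i ∈ Finset.range N, (K ^ 2 + N * δ) := by
        refine Finset.sum_congr rfl fun i hi => ?_
        rw [Finset.sum_add_distrib, Finset.sum_ite_eq, if_pos hi]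
        simp
    _ = _ := by
        rw [Finset.sum_const, Finset.card_range, nsmul_eq_mul]; ring

lemma norm_commutator_le (b u : B) (hu : ‖u‖ ≤ 1) : ‖b * u - u * b‖ ≤ 2 * ‖b‖ := by
  have h₁ : ‖b * u‖ ≤ ‖b‖ := (norm_mul_le _ _).trans (mul_le_of_le_one_right (norm_nonneg _) hu)
  have h₂ : ‖u * b‖ ≤ ‖b‖ := (norm_mul_le _ _).trans (mul_le_of_le_one_left (norm_nonneg _) hu)
  linarith [norm_sub_le (b * u) (u * b)]

/-- If `w` is almost a unit for `u` and `u'` is almost a unit for `w`, then the commutators of `u`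
and `u'` with `b` have a small product. -/
lemma norm_commutator_mul_commutator_le {b u w u' : B} {R δ : ℝ} (hR : ‖b‖ ≤ R)
    (hu : ‖u‖ ≤ 1) (hu' : ‖u'‖ ≤ 1) (h₁ : ‖u * w - u‖ ≤ δ) (h₂ : ‖u * b * w - u * b‖ ≤ δ)
    (h₃ : ‖w * u' - w‖ ≤ δ) (h₄ : ‖w * b * u' - w * b‖ ≤ δ) :
    ‖(b * u - u * b) * (b * u' - u' * b)‖ ≤ 4 * R * (R + 1) * δ := by
  have hR₀ : 0 ≤ R := (norm_nonneg _).trans hR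
  have hδ : 0 ≤ δ := (norm_nonneg _).trans h₁
  have c₁ : ‖b * u - u * b‖ ≤ 2 * R := (norm_commutator_le b u hu).trans (by linarith)
  have c₂ : ‖b * u' - u' * b‖ ≤ 2 * R := (norm_commutator_le b u' hu').trans (by linarith)
  have e₁ : ‖b * (u * w - u) - (u * b * w - u * b)‖ ≤ (R + 1) * δ := by
    refine (norm_sub_le _ _).trans ?_
    have : ‖b * (u * w - u)‖ ≤ R * δ :=
      (norm_mul_le _ _).trans (mul_le_mul hR h₁ (norm_nonneg _) hR₀)
    linarith
  have e₂ : ‖(w * b * u' - w * b) - (w * u' - w) * b‖ ≤ (R + 1) * δ := by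
    refine (norm_sub_le _ _).trans ?_
    have : ‖(w * u' - w) * b‖ ≤ δ * R :=
      (norm_mul_le _ _).trans (mul_le_mul h₃ hR (norm_nonneg _) hδ)
    linarith
  -- With `c`, `c'` the two commutators, this is `c * c' = c * (w * c') - (c * w - c) * c'`: `w`
  -- almost fixes `c` on the right and almost kills `c'` on the left.
  have : (b * u - u * b) * (b * u' - u' * b) =
      (b * u - u * b) * ((w * b * u' - w * b) - (w * u' - w) * b) -
        (b * (u * w - u) - (u * b * w - u * b)) * (b * u' - u' * b) := by
    noncomm_ring
  rw [this]
  calc _ ≤ 2 * R * ((R + 1) * δ) + (R + 1) * δ * (2 * R) := by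
        refine (norm_sub_le _ _).trans (add_le_add ?_ ?_)
        · exact (norm_mul_le _ _).trans (mul_le_mul c₁ e₂ (norm_nonneg _) (by positivity))
        · exact (norm_mul_le _ _).trans (mul_le_mul e₁ c₂ (norm_nonneg _) (by positivity))
    _ = _ := by ring

/-- The kernel of a ⋆-homomorphism has a quasicentral approximate unit. -/
theorem exists_isCutoff_quasicentral (ρ : B →⋆ₙₐ[ℂ] C) (T S : Finset B)
    (hT : ∀ a ∈ T, ρ a = 0) (hS : ∀ b ∈ S, IsSelfAdjoint b) {η : ℝ} (hη : 0 < η) :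
    ∃ u, IsCutoff ρ u ∧ (∀ a ∈ T, ‖a * u - a‖ < η) ∧ ∀ b ∈ S, ‖b * u - u * b‖ < η := by
  classical
  obtain ⟨R, hR₀, hR⟩ : ∃ R : ℝ, 0 ≤ R ∧ ∀ b ∈ S, ‖b‖ ≤ R :=
    ⟨∑ b ∈ S, ‖b‖, by positivity, fun b hb => Finset.single_le_sum (f := fun b => ‖b‖)
      (fun _ _ => norm_nonneg _) hb⟩
  -- Averaging `N` almost orthogonal commutators of norm at most `2 * R` leaves a squared norm of
  -- about `(2 * R) ^ 2 / N`. Half of `η ^ 2` is reserved for this, half for the failure of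
  -- orthogonality, controlled by `δ`.
  obtain ⟨N, hN⟩ := exists_nat_gt (max 0 ((2 * R) ^ 2 / (η ^ 2 / 2)))
  have hN₀ : (0 : ℝ) < N := (le_max_left _ _).trans_lt hN
  have hN₁ : (2 * R) ^ 2 < N * (η ^ 2 / 2) := by
    rw [← div_lt_iff₀ (by positivity)]; exact (le_max_right _ _).trans_lt hN
  set δ : ℝ := η ^ 2 / 2 / (4 * R * (R + 1) + 1) with hδ
  have hδ₀ : 0 < δ := by positivity
  have hδ₁ : 4 * R * (R + 1) * δ ≤ η ^ 2 / 2 := by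
    have : (4 * R * (R + 1) + 1) * δ = η ^ 2 / 2 := by rw [hδ]; field_simp
    linarith
  obtain ⟨v, hv, hvr⟩ := exists_seq_of_forall_finset_exists
    (fun u => IsCutoff ρ u ∧ ∀ a ∈ T, ‖a * u - a‖ < η)
    (fun x y => ‖x * y - x‖ < δ ∧ ∀ b ∈ S, ‖x * b * y - x * b‖ < δ) (by
      intro s hs
      obtain ⟨u, hu, hu'⟩ := exists_isCutoff_norm_mul_sub_lt ρ
        (T ∪ (s ∪ (s ×ˢ S).image fun p => p.1 * p.2)) (by
          intro a ha
          simp only [Finset.mem_union, Finset.mem_image, Finset.mem_product, Prod.exists] at ha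
          rcases ha with ha | ha | ⟨x, b, ⟨hx, _⟩, rfl⟩
          · exact hT a ha
          · exact (hs a ha).1.map_eq_zero
          · rw [map_mul, (hs x hx).1.map_eq_zero, zero_mul]) (lt_min hη hδ₀)
      refine ⟨u, ⟨hu, fun a ha => (hu' a (by simp [ha])).trans_le (min_le_left _ _)⟩,
        fun x hx => ⟨(hu' x (by simp [hx])).trans_le (min_le_right _ _), fun b hb =>
          (hu' (x * b) ?_).trans_le (min_le_right _ _)⟩⟩
      simp only [Finset.mem_union, Finset.mem_image, Finset.mem_product, Prod.exists]
      exact Or.inr (Or.inr ⟨x, b, ⟨hx, hb⟩, rfl⟩))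
  have hNc : (N : ℂ) ≠ 0 := by exact_mod_cast hN₀.ne'
  have hn : ‖(N : ℂ)⁻¹‖ = (N : ℝ)⁻¹ := by simp
  -- Only even terms are averaged; the odd term `v (2 * i + 1)` is the intermediate unit `w` between
  -- `v (2 * i)` and any later even term.
  refine ⟨_, IsCutoff.average (u := fun i => v (2 * i)) (by exact_mod_cast hN₀) fun i => (hv _).1,
    fun a ha => ?_, fun b hb => ?_⟩
  · have : a * ((N : ℂ)⁻¹ • ∑ i ∈ Finset.range N, v (2 * i)) - a =
        (N : ℂ)⁻¹ • ∑ i ∈ Finset.range N, (a * v (2 * i) - a) := by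
      rw [Finset.sum_sub_distrib, smul_sub, mul_smul_comm, Finset.mul_sum, Finset.sum_const,
        Finset.card_range, ← Nat.cast_smul_eq_nsmul ℂ, smul_smul, inv_mul_cancel₀ hNc, one_smul]
    rw [this, norm_smul, hn, inv_mul_lt_iff₀ hN₀]
    calc _ ≤ ∑ i ∈ Finset.range N, ‖a * v (2 * i) - a‖ := norm_sum_le _ _
      _ < ∑ i ∈ Finset.range N, η :=
        Finset.sum_lt_sum_of_nonempty (by simpa using hN₀.ne') fun i _ => (hv _).2 a ha
      _ = N * η := by simp
  · have hcomm : b * ((N : ℂ)⁻¹ • ∑ i ∈ Finset.range N, v (2 * i)) -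
        ((N : ℂ)⁻¹ • ∑ i ∈ Finset.range N, v (2 * i)) * b =
        (N : ℂ)⁻¹ • ∑ i ∈ Finset.range N, (b * v (2 * i) - v (2 * i) * b) := by
      rw [Finset.sum_sub_distrib, smul_sub, mul_smul_comm, smul_mul_assoc, Finset.mul_sum,
        Finset.sum_mul]
    have hb' := (hS b hb).star_eq
    have hsum := norm_sum_sq_le (N := N) (c := fun i => b * v (2 * i) - v (2 * i) * b)
      (K := 2 * R) (δ := 4 * R * (R + 1) * δ)
      (fun i => by
        simp only [star_sub, star_mul, hb', (hv (2 * i)).1.isSelfAdjoint.star_eq]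
        abel)
      (fun i => (norm_commutator_le _ _ (hv _).1.norm_le).trans (by linarith [hR b hb]))
      (by positivity)
      (fun i j hij => by
        have r₁ := hvr (2 * i) (2 * i + 1) (by omega)
        have r₂ := hvr (2 * i + 1) (2 * j) (by omega)
        exact norm_commutator_mul_commutator_le (hR b hb) (hv _).1.norm_le (hv _).1.norm_le
          r₁.1.le (r₁.2 b hb).le r₂.1.le (r₂.2 b hb).le)
    rw [hcomm, norm_smul, hn, inv_mul_lt_iff₀ hN₀]
    refine lt_of_pow_lt_pow_left₀ 2 (by positivity) (hsum.trans_lt ?_)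
    calc (N : ℝ) * (2 * R) ^ 2 + N ^ 2 * (4 * R * (R + 1) * δ)
        < N * (N * (η ^ 2 / 2)) + N ^ 2 * (η ^ 2 / 2) :=
          add_lt_add_of_lt_of_le (by gcongr) (by gcongr)
      _ = (N * η) ^ 2 := by ring

end Cutoff

/-! ### Bounded sequences modulo null sequences -/

section Asymptotic

/-- The bounded sequences in a normed ring. -/
def boundedSeq (E : Type*) [NormedRing E] : Subring (ℕ → E) where
  carrier := {a | ∃ K, ∀ n, ‖a n‖ ≤ K}
  mul_mem' := by
    rintro a b ⟨K, hK⟩ ⟨L, hL⟩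
    exact ⟨K * L, fun n => (norm_mul_le _ _).trans
      (mul_le_mul (hK n) (hL n) (norm_nonneg _) ((norm_nonneg _).trans (hK n)))⟩
  one_mem' := ⟨‖(1 : E)‖, fun _ => le_rfl⟩
  add_mem' := by
    rintro a b ⟨K, hK⟩ ⟨L, hL⟩
    exact ⟨K + L, fun n => (norm_add_le _ _).trans (add_le_add (hK n) (hL n))⟩
  zero_mem' := ⟨0, fun _ => by simp⟩
  neg_mem' := by
    rintro a ⟨K, hK⟩
    exact ⟨K, fun n => by simpa using hK n⟩

lemma tendsto_mul_zero_of_norm_le {E : Type*} [NormedRing E] {a b : ℕ → E} {K : ℝ}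
    (ha : ∀ n, ‖a n‖ ≤ K) (hb : Tendsto b atTop (𝓝 0)) :
    Tendsto (fun n => a n * b n) atTop (𝓝 0) := by
  refine squeeze_zero_norm (a := fun n => K * ‖b n‖) (fun n => ?_)
    (by simpa using hb.norm.const_mul K)
  exact (norm_mul_le _ _).trans (mul_le_mul_of_nonneg_right (ha n) (norm_nonneg _))

lemma tendsto_zero_mul_of_norm_le {E : Type*} [NormedRing E] {a b : ℕ → E} {K : ℝ}
    (ha : ∀ n, ‖a n‖ ≤ K) (hb : Tendsto b atTop (𝓝 0)) :
    Tendsto (fun n => b n * a n) atTop (𝓝 0) := by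
  refine squeeze_zero_norm (a := fun n => ‖b n‖ * K) (fun n => ?_)
    (by simpa using hb.norm.mul_const K)
  exact (norm_mul_le _ _).trans (mul_le_mul_of_nonneg_left (ha n) (norm_nonneg _))

/-- Two bounded sequences are asymptotically equal if their difference tends to zero. -/
def asymptoticCon (E : Type*) [NormedRing E] : RingCon (boundedSeq E) where
  r a b := Tendsto (fun n => (a : ℕ → E) n - (b : ℕ → E) n) atTop (𝓝 0)
  iseqv :=
    { refl := fun a => by simp
      symm := fun {a b} h => by simpa using h.neg
      trans := fun {a b c} h h' => by simpa using h.add h' }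
  add' := fun {a b c d} h h' => by
    have := h.add h'
    simp only [add_zero] at this
    refine this.congr fun n => ?_
    simp only [Subring.coe_add, Pi.add_apply]
    abel
  mul' := fun {a b c d} h h' => by
    obtain ⟨K, hK⟩ := a.2
    obtain ⟨L, hL⟩ := d.2
    have := (tendsto_mul_zero_of_norm_le hK h').add (tendsto_zero_mul_of_norm_le hL h)
    simp only [add_zero] at this
    refine this.congr fun n => ?_
    simp only [Subring.coe_mul, Pi.mul_apply]
    noncomm_ring

lemma asymptoticCon_eq_iff {E : Type*} [NormedRing E] {a b : boundedSeq E} :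
    (a : (asymptoticCon E).Quotient) = b ↔
      Tendsto (fun n => (a : ℕ → E) n - (b : ℕ → E) n) atTop (𝓝 0) :=
  (asymptoticCon E).eq

variable {Q : Type*} [Ring Q] {f h k w σ : Q}

lemma compressed_product_eq (hh : Commute f h) (hk : Commute f k) :
    f * h * f * (f * k * f) = f ^ 4 * (h * k) := by
  have h₃ : h * (f * f * f) = f * f * f * h :=
    (((hh.mul_left hh).mul_left hh).eq).symm
  calc f * h * f * (f * k * f) = f * h * f * f * (k * f) := by noncomm_ring
    _ = f * (h * (f * f * f)) * k := by rw [← hk.eq]; noncomm_ring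
    _ = f ^ 4 * (h * k) := by rw [h₃]; noncomm_ring

lemma pow_mul_eq_of_mul_eq (hσ : Commute f σ) (hw : f * w = σ * w) (n : ℕ) :
    f ^ n * w = σ ^ n * w := by
  induction n with
  | zero => simp
  | succ n ih =>
    rw [pow_succ', mul_assoc, ih, ← mul_assoc, (hσ.pow_right n).eq, mul_assoc, hw, ← mul_assoc,
      pow_succ]

/-- Each of the `n` factors contains `f` eight times. All of them move next to `w`, where `f` acts
as `σ`. -/
lemma compressed_product_pow_mul_eq (hh : Commute f h) (hk : Commute f k) (hσ : Commute f σ)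
    (hw : f * w = σ * w) (n : ℕ) :
    (f * k * f * (f * h * f) * (f * h * f * (f * k * f))) ^ n * w =
      (k * h * (h * k)) ^ n * (σ ^ (8 * n) * w) := by
  have hP : Commute f (k * h * (h * k)) := (hk.mul_right hh).mul_right (hh.mul_right hk)
  have e : f * k * f * (f * h * f) * (f * h * f * (f * k * f)) =
      f ^ 8 * (k * h * (h * k)) := by
    rw [compressed_product_eq hh hk, compressed_product_eq hk hh]
    have : k * h * f ^ 4 = f ^ 4 * (k * h) := (((hk.mul_right hh).pow_left 4).eq).symm
    calc f ^ 4 * (k * h) * (f ^ 4 * (h * k)) = f ^ 4 * (k * h * f ^ 4) * (h * k) := by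
          noncomm_ring
      _ = _ := by rw [this]; noncomm_ring
  rw [e, (hP.pow_left 8).mul_pow, ← pow_mul, ((hP.pow_left (8 * n)).pow_right n).eq, mul_assoc,
    pow_mul_eq_of_mul_eq hσ hw]

end Asymptotic

/-! ### From exact identities in the quotient to limits -/

section Tendsto

variable {E : Type*} [NormedRing E]

/-- Asymptotic commutation is genuine commutation modulo null sequences, so the purely algebraic
identity applies there without any error bookkeeping. -/
lemma tendsto_compressed_product {h k : E} {f : ℕ → E} {K : ℝ} (hf : ∀ m, ‖f m‖ ≤ K)
    (hh : Tendsto (fun m => f m * h - h * f m) atTop (𝓝 0))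
    (hk : Tendsto (fun m => f m * k - k * f m) atTop (𝓝 0)) :
    Tendsto (fun m => f m * h * f m * (f m * k * f m) - f m ^ 4 * (h * k)) atTop (𝓝 0) := by
  let F : boundedSeq E := ⟨f, K, hf⟩
  let c (a : E) : boundedSeq E := ⟨fun _ => a, ‖a‖, fun _ => le_rfl⟩
  have h₁ : (F * c h : (asymptoticCon E).Quotient) = (c h * F : boundedSeq E) :=
    asymptoticCon_eq_iff.mpr hh
  have h₂ : (F * c k : (asymptoticCon E).Quotient) = (c k * F : boundedSeq E) :=
    asymptoticCon_eq_iff.mpr hk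
  exact (asymptoticCon_eq_iff (a := F * c h * F * (F * c k * F)) (b := F ^ 4 * (c h * c k))).mp
    (compressed_product_eq (Q := (asymptoticCon E).Quotient) h₁ h₂)

lemma tendsto_compressed_product_pow_mul {h k w σ : E} {f : ℕ → E} {K : ℝ}
    (hf : ∀ m, ‖f m‖ ≤ K)
    (hh : Tendsto (fun m => f m * h - h * f m) atTop (𝓝 0))
    (hk : Tendsto (fun m => f m * k - k * f m) atTop (𝓝 0))
    (hσ : ∀ a : E, Commute a σ) (hw : Tendsto (fun m => f m * w - σ * w) atTop (𝓝 0)) (n : ℕ) :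
    Tendsto (fun m =>
      (f m * k * f m * (f m * h * f m) * (f m * h * f m * (f m * k * f m))) ^ n * w -
      (k * h * (h * k)) ^ n * (σ ^ (8 * n) * w)) atTop (𝓝 0) := by
  let F : boundedSeq E := ⟨f, K, hf⟩
  let c (a : E) : boundedSeq E := ⟨fun _ => a, ‖a‖, fun _ => le_rfl⟩
  have h₁ : (F * c h : (asymptoticCon E).Quotient) = (c h * F : boundedSeq E) :=
    asymptoticCon_eq_iff.mpr hh
  have h₂ : (F * c k : (asymptoticCon E).Quotient) = (c k * F : boundedSeq E) :=
    asymptoticCon_eq_iff.mpr hk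
  have h₃ : (F * c σ : (asymptoticCon E).Quotient) = (c σ * F : boundedSeq E) :=
    congrArg _ (Subtype.ext (funext fun m => (hσ (f m)).eq))
  have h₄ : (F * c w : (asymptoticCon E).Quotient) = (c σ * c w : boundedSeq E) :=
    asymptoticCon_eq_iff.mpr hw
  exact (asymptoticCon_eq_iff
    (a := (F * c k * F * (F * c h * F) * (F * c h * F * (F * c k * F))) ^ n * c w)
    (b := (c k * c h * (c h * c k)) ^ n * (c σ ^ (8 * n) * c w))).mp
    (compressed_product_pow_mul_eq (Q := (asymptoticCon E).Quotient) h₁ h₂ h₃ h₄ n)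

end Tendsto

/-! ### The norm of the compressed product -/

section Norm

variable {E : Type*} [CStarAlgebra E]

lemma norm_pow_two_pow_succ (z : E) (p : ℕ) :
    ‖(star z * z) ^ 2 ^ p‖ = ‖z‖ ^ 2 ^ (p + 1) := by
  have := congrArg NNReal.toReal ((IsSelfAdjoint.star_mul_self z).nnnorm_pow_two_pow p)
  simp only [coe_nnnorm, NNReal.coe_pow] at this
  rw [this, CStarRing.norm_star_mul_self, ← sq, ← pow_mul, pow_succ, mul_comm]

lemma norm_pow_mul_le {E : Type*} [NormedRing E] (x y : E) (n : ℕ) :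
    ‖x ^ n * y‖ ≤ ‖x‖ ^ n * ‖y‖ := by
  induction n with
  | zero => simp
  | succ n ih =>
    rw [pow_succ', mul_assoc, pow_succ', mul_assoc]
    exact (norm_mul_le _ _).trans (mul_le_mul_of_nonneg_left ih (norm_nonneg _))

/-- If `f` asymptotically commutes with `h` and `k` and is asymptotically the scalar `s` on `w`,
and `h k` is small away from `w`, then the product of `f h f` and `f k f` is eventually as small as
the larger one of `h k` away from `w` and `s ^ 4` times `h k`. -/
lemma eventually_norm_compressed_product_lt {h k w : E} (hh : IsSelfAdjoint h)
    (hk : IsSelfAdjoint k) (hw : ‖w‖ ≤ 1) {f : ℕ → E} (hf : ∀ m, IsSelfAdjoint (f m))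
    (hf₁ : ∀ m, ‖f m‖ ≤ 1) (hfh : Tendsto (fun m => f m * h - h * f m) atTop (𝓝 0))
    (hfk : Tendsto (fun m => f m * k - k * f m) atTop (𝓝 0)) {s : ℝ} (hs : 0 ≤ s)
    (hfw : Tendsto (fun m => f m * w - algebraMap ℂ E s * w) atTop (𝓝 0)) {ε₁ r : ℝ}
    (hε : ‖h * k * (1 - w)‖ ≤ ε₁) (hr : ε₁ < r) (hr' : s ^ 4 * ‖h * k‖ < r) :
    ∀ᶠ m in atTop, ‖f m * h * f m * (f m * k * f m)‖ < r := by
  have hε₀ : 0 ≤ ε₁ := (norm_nonneg _).trans hε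
  have hr₀ : 0 < r := hε₀.trans_lt hr
  set a := s ^ 4 * ‖h * k‖ with ha
  have ha₀ : 0 ≤ a := by positivity
  -- After division by `r ^ 2 ^ (p + 1)` this reads `(a / r) ^ 2 ^ (p + 1) < (r - ε₁) / r`, which
  -- holds for large `p` because `a < r`.
  obtain ⟨p, hp⟩ : ∃ p : ℕ, a ^ 2 ^ (p + 1) < r ^ (2 ^ (p + 1) - 1) * (r - ε₁) := by
    have h₁ : Tendsto (fun n : ℕ => (a / r) ^ n) atTop (𝓝 0) :=
      tendsto_pow_atTop_nhds_zero_of_lt_one (by positivity) ((div_lt_one hr₀).mpr hr')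
    have h₂ : ∀ᶠ n in atTop, (a / r) ^ n < (r - ε₁) / r :=
      h₁.eventually_lt_const (div_pos (sub_pos.mpr hr) hr₀)
    have h₃ : Tendsto (fun p : ℕ => 2 ^ (p + 1)) atTop atTop :=
      (tendsto_pow_atTop_atTop_of_one_lt (by norm_num : 1 < 2)).comp (tendsto_add_atTop_nat 1)
    obtain ⟨p, hp⟩ := (h₃.eventually h₂).exists
    refine ⟨p, ?_⟩
    rw [div_pow, div_lt_iff₀ (by positivity)] at hp
    refine hp.trans_eq ?_
    have : r ^ 2 ^ (p + 1) = r ^ (2 ^ (p + 1) - 1) * r := by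
      rw [← pow_succ, Nat.sub_add_cancel Nat.one_le_two_pow]
    rw [this]; field_simp
  set q := 2 ^ (p + 1) with hq
  have hq₁ : q = q - 1 + 1 := (Nat.sub_add_cancel Nat.one_le_two_pow).symm
  have hq₂ : q = 2 * 2 ^ p := by rw [hq, pow_succ, mul_comm]
  set Z : ℕ → E := fun m => f m * h * f m * (f m * k * f m) with hZ
  have hZs : ∀ m, star (Z m) = f m * k * f m * (f m * h * f m) := fun m => by
    simp [hZ, hh.star_eq, hk.star_eq, (hf m).star_eq, mul_assoc]
  have hE := (tendsto_zero_mul_of_norm_le (a := fun _ => 1 - w) (fun _ => le_rfl)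
    (tendsto_compressed_product hf₁ hfh hfk)).norm
  have hD := (tendsto_compressed_product_pow_mul hf₁ hfh hfk
    (fun a => (Algebra.commutes (s : ℂ) a).symm) hfw (2 ^ p)).norm
  have hlim : Tendsto (fun m => r ^ (q - 1) *
      (r - ε₁ - ‖(Z m - f m ^ 4 * (h * k)) * (1 - w)‖)) atTop (𝓝 (r ^ (q - 1) * (r - ε₁))) := by
    simpa using (tendsto_const_nhds.sub hE).const_mul (r ^ (q - 1))
  have hlim' : Tendsto (fun m => a ^ q + ‖(f m * k * f m * (f m * h * f m) * Z m) ^ 2 ^ p * w -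
      (k * h * (h * k)) ^ 2 ^ p * (algebraMap ℂ E s ^ (8 * 2 ^ p) * w)‖) atTop (𝓝 (a ^ q)) := by
    simpa using hD.const_add (a ^ q)
  have hEr : ∀ᶠ m in atTop, ‖(Z m - f m ^ 4 * (h * k)) * (1 - w)‖ < r - ε₁ := by
    refine hE.eventually_lt_const ?_
    simpa using hr
  filter_upwards [hlim'.eventually_lt hlim hp, hEr] with m hm hmE
  by_contra! hcon
  change r ≤ ‖Z m‖ at hcon
  have b₁ : ‖(star (Z m) * Z m) ^ 2 ^ p * w‖ ≤ a ^ q +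
      ‖(f m * k * f m * (f m * h * f m) * Z m) ^ 2 ^ p * w -
      (k * h * (h * k)) ^ 2 ^ p * (algebraMap ℂ E s ^ (8 * 2 ^ p) * w)‖ := by
    rw [hZs]
    have hP : ‖(k * h * (h * k)) ^ 2 ^ p * (algebraMap ℂ E s ^ (8 * 2 ^ p) * w)‖ ≤ a ^ q := by
      have hy : k * h * (h * k) = star (h * k) * (h * k) := by
        rw [star_mul, hh.star_eq, hk.star_eq]
      rw [← map_pow, ← Algebra.smul_def, mul_smul_comm, norm_smul, hy]
      calc _ ≤ s ^ (8 * 2 ^ p) * (‖h * k‖ ^ q * 1) := by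
            gcongr
            · simp [abs_of_nonneg hs]
            · refine (norm_mul_le _ _).trans ?_
              rw [norm_pow_two_pow_succ]
              gcongr
        _ = a ^ q := by rw [ha, mul_pow, ← pow_mul, hq₂]; ring_nf
    calc _ ≤ ‖(k * h * (h * k)) ^ 2 ^ p * (algebraMap ℂ E s ^ (8 * 2 ^ p) * w)‖ + _ :=
          norm_le_norm_add_norm_sub _ _
      _ ≤ _ := by rw [norm_sub_rev]; gcongr
  have b₂ : ‖(star (Z m) * Z m) ^ 2 ^ p * (1 - w)‖ ≤
      ‖Z m‖ ^ (q - 1) * (ε₁ + ‖(Z m - f m ^ 4 * (h * k)) * (1 - w)‖) := by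
    -- Only the last factor `Z m` meets `1 - w`, where it is nearly `f m ^ 4 * (h * k)` and hence
    -- bounded by about `ε₁`; the other `q - 1` factors are estimated by `‖Z m‖`.
    have e : (star (Z m) * Z m) ^ 2 ^ p * (1 - w) =
        (star (Z m) * Z m) ^ (2 ^ p - 1) * star (Z m) * (Z m * (1 - w)) := by
      rw [← Nat.sub_add_cancel (Nat.one_le_two_pow : 1 ≤ 2 ^ p), pow_succ,
        Nat.add_sub_cancel]
      noncomm_ring
    rw [e]
    refine (norm_mul_le _ _).trans (mul_le_mul ?_ ?_ (norm_nonneg _) (by positivity))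
    · calc _ ≤ ‖star (Z m) * Z m‖ ^ (2 ^ p - 1) * ‖star (Z m)‖ := by
            exact norm_pow_mul_le _ _ _
        _ = ‖Z m‖ ^ (q - 1) := by
            rw [CStarRing.norm_star_mul_self, norm_star, ← sq, ← pow_mul, ← pow_succ]
            congr 1
            have : 1 ≤ 2 ^ p := Nat.one_le_two_pow
            omega
    · have hf4 : ‖f m ^ 4‖ ≤ 1 :=
        (norm_pow_le' _ (by norm_num)).trans (pow_le_one₀ (norm_nonneg _) (hf₁ m))
      have : Z m * (1 - w) = f m ^ 4 * (h * k * (1 - w)) +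
          (Z m - f m ^ 4 * (h * k)) * (1 - w) := by noncomm_ring
      rw [this]
      refine (norm_add_le _ _).trans (add_le_add ?_ le_rfl)
      exact ((norm_mul_le _ _).trans (mul_le_of_le_one_left (norm_nonneg _) hf4)).trans hε
  have b₃ : ‖Z m‖ ^ q ≤ ‖(star (Z m) * Z m) ^ 2 ^ p * w‖ +
      ‖(star (Z m) * Z m) ^ 2 ^ p * (1 - w)‖ := by
    rw [hq, ← norm_pow_two_pow_succ]
    refine le_trans (le_of_eq ?_) (norm_add_le _ _)
    rw [← mul_add, add_sub_cancel, mul_one]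
  have b₄ : r ^ (q - 1) * (r - ε₁ - ‖(Z m - f m ^ 4 * (h * k)) * (1 - w)‖) ≤
      ‖Z m‖ ^ (q - 1) * (‖Z m‖ - ε₁ - ‖(Z m - f m ^ 4 * (h * k)) * (1 - w)‖) := by
    refine mul_le_mul (by gcongr) (by linarith) (by linarith) (by positivity)
  have b₅ : ‖Z m‖ ^ q = ‖Z m‖ ^ (q - 1) * ‖Z m‖ := by
    rw [← pow_succ, ← hq₁]
  -- The bounds give `‖Z m‖ ^ q ≤ a ^ q + ‖Z m‖ ^ (q - 1) * ε₁` up to vanishing errors, which `r ≤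
  -- ‖Z m‖` and the choice of `p` contradict.
  nlinarith

end Norm

/-! ### Lifting the relations along a surjection -/

section Lift

variable {B C : Type*} [NonUnitalCStarAlgebra B] [NonUnitalCStarAlgebra C]

/-- If `ρ y` has norm at most `ε`, then some cutoff in the kernel of `ρ` removes the part of `y`
that has larger norm. -/
lemma exists_isCutoff_norm_mul_one_sub_le (ρ : B →⋆ₙₐ[ℂ] C) {y : B} {ε ε₁ : ℝ} (hε : 0 ≤ ε)
    (hε₁ : ε < ε₁) (hy : ‖ρ y‖ ≤ ε) :
    ∃ w, IsCutoff ρ w ∧ ‖(y : Unitization ℂ B) * (1 - w)‖ ≤ ε₁ := by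
  let _ : PartialOrder B := CStarAlgebra.spectralOrder B
  have _ : StarOrderedRing B := CStarAlgebra.spectralOrderedRing B
  -- The part of `star y * y` above `ε ^ 2` lies in the kernel because `‖ρ y‖ ≤ ε`; what remains has
  -- norm at most `ε ^ 2`. An approximate unit `w` for the former leaves only `ε₁ ^ 2 - ε ^ 2` of
  -- it.
  let g : ℝ → ℝ := fun s => max (s - ε ^ 2) 0
  have hg : Continuous g := by fun_prop
  have hg₀ : g 0 = 0 := by simp [g, sq_nonneg]
  have hsa : IsSelfAdjoint (star y * y) := .star_mul_self y
  have hρ : ρ (cfcₙ g (star y * y)) = 0 := by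
    rw [NonUnitalStarAlgHom.map_cfcₙ ρ g (star y * y) hg.continuousOn hg₀ (map_continuous ρ) hsa
      (hsa.map ρ), ← cfcₙ_zero ℝ (ρ (star y * y))]
    refine cfcₙ_congr fun s hs => ?_
    have hs' : ‖s‖ ≤ ‖ρ (star y * y)‖ :=
      NonUnitalIsometricContinuousFunctionalCalculus.norm_quasispectrum_le _ hs (hsa.map ρ)
    rw [map_mul, map_star, CStarRing.norm_star_mul_self, ← sq] at hs'
    have h₂ : ‖ρ y‖ ^ 2 ≤ ε ^ 2 := by gcongr
    exact max_eq_right (sub_nonpos.mpr ((le_abs_self s).trans (hs'.trans h₂)))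
  have hq : ‖star y * y - cfcₙ g (star y * y)‖ ≤ ε ^ 2 := by
    nth_rw 1 [← cfcₙ_id' ℝ (star y * y)]
    rw [← cfcₙ_sub (fun s => s) g _ (by fun_prop) rfl hg.continuousOn hg₀]
    refine norm_cfcₙ_le fun s hs => ?_
    have hs₀ : 0 ≤ s := quasispectrum_nonneg_of_nonneg _ (star_mul_self_nonneg y) s hs
    rw [Real.norm_eq_abs, abs_le]
    rcases le_total (s - ε ^ 2) 0 with h | h
    · simp only [g, max_eq_right h]; constructor <;> nlinarith
    · simp only [g, max_eq_left h]; constructor <;> nlinarith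
  set p := cfcₙ g (star y * y) with hp
  have hη : 0 < ε₁ ^ 2 - ε ^ 2 := by nlinarith
  obtain ⟨w, hw, hw'⟩ := exists_isCutoff_norm_mul_sub_lt ρ {p} (by simpa using hρ) hη
  refine ⟨w, hw, ?_⟩
  have hws : star (1 - (w : Unitization ℂ B)) = 1 - w := by
    rw [star_sub, star_one, ← Unitization.inr_star, hw.isSelfAdjoint.star_eq]
  have hpw : ‖(p : Unitization ℂ B) * (1 - w)‖ ≤ ε₁ ^ 2 - ε ^ 2 := by
    have := (hw' p (by simp)).le
    rw [← Unitization.norm_inr (𝕜 := ℂ), ← norm_neg] at this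
    have e : (p : Unitization ℂ B) * (1 - w) = -((p * w - p : B) : Unitization ℂ B) := by
      rw [Unitization.inr_sub, Unitization.inr_mul]; noncomm_ring
    rwa [e]
  refine le_of_sq_le_sq ?_ (hε.trans hε₁.le)
  rw [sq, ← CStarRing.norm_star_mul_self, star_mul, hws]
  have e : (1 - (w : Unitization ℂ B)) * star (y : Unitization ℂ B) * (y * (1 - w)) =
      (1 - w) * ((star y * y - p : B) : Unitization ℂ B) * (1 - w) + (1 - w) * (p * (1 - w)) := by
    rw [Unitization.inr_sub, Unitization.inr_mul, Unitization.inr_star]; noncomm_ring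
  rw [e]
  have hn := hw.norm_one_sub_le
  calc _ ≤ 1 * ε ^ 2 * 1 + 1 * (ε₁ ^ 2 - ε ^ 2) := by
        refine (norm_add_le _ _).trans (add_le_add ?_ ?_)
        · refine (norm_mul_le _ _).trans (mul_le_mul ((norm_mul_le _ _).trans
            (mul_le_mul hn ?_ (norm_nonneg _) zero_le_one)) hn (norm_nonneg _) (by positivity))
          rwa [Unitization.norm_inr]
        · exact (norm_mul_le _ _).trans (mul_le_mul hn hpw (norm_nonneg _) zero_le_one)
    _ = ε₁ ^ 2 := by ring

/-- The element `(1 - t u) a (1 - t u)`, expanded. -/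
def squeeze (t : ℝ) (u a : B) : B :=
  a - (t : ℂ) • (u * a + a * u) + (t : ℂ) ^ 2 • (u * a * u)

lemma inr_squeeze (t : ℝ) (u a : B) :
    ((squeeze t u a : B) : Unitization ℂ B) =
      (1 - (t : ℂ) • (u : Unitization ℂ B)) * a * (1 - (t : ℂ) • (u : Unitization ℂ B)) := by
  simp only [squeeze, Unitization.inr_add, Unitization.inr_sub, Unitization.inr_smul,
    Unitization.inr_mul, sub_mul, mul_sub, one_mul, mul_one, smul_mul_assoc, mul_smul_comm,
    smul_add, smul_sub, smul_smul, sq]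
  abel

lemma IsCutoff.map_squeeze {ρ : B →⋆ₙₐ[ℂ] C} {u : B} (hu : IsCutoff ρ u) (t : ℝ) (a : B) :
    ρ (squeeze t u a) = ρ a := by
  simp only [squeeze, map_add, map_sub, map_smul, map_mul, hu.map_eq_zero, zero_mul, mul_zero,
    add_zero, smul_zero, sub_zero]

lemma norm_squeeze_sub_le {t : ℝ} (ht₀ : 0 ≤ t) (ht₁ : t ≤ 1) {u a : B} (hu : ‖u‖ ≤ 1)
    (ha : ‖a‖ ≤ 1) : ‖squeeze t u a - a‖ ≤ 3 * t := by
  have h₁ : ‖u * a‖ ≤ 1 := (norm_mul_le _ _).trans (mul_le_one₀ hu (norm_nonneg _) ha)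
  have h₂ : ‖a * u‖ ≤ 1 := (norm_mul_le _ _).trans (mul_le_one₀ ha (norm_nonneg _) hu)
  have h₃ : ‖u * a * u‖ ≤ 1 := (norm_mul_le _ _).trans (mul_le_one₀ h₁ (norm_nonneg _) hu)
  have e : squeeze t u a - a = (t : ℂ) ^ 2 • (u * a * u) - (t : ℂ) • (u * a + a * u) := by
    simp only [squeeze]; abel
  rw [e]
  have h₄ : ‖(t : ℂ) ^ 2 • (u * a * u)‖ ≤ t := by
    rw [norm_smul, norm_pow, Complex.norm_real, Real.norm_of_nonneg ht₀]
    nlinarith [norm_nonneg (u * a * u)]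
  have h₅ : ‖(t : ℂ) • (u * a + a * u)‖ ≤ 2 * t := by
    rw [norm_smul, Complex.norm_real, Real.norm_of_nonneg ht₀]
    nlinarith [norm_add_le (u * a) (a * u)]
  linarith [norm_sub_le ((t : ℂ) ^ 2 • (u * a * u)) ((t : ℂ) • (u * a + a * u))]

lemma IsCutoff.isSelfAdjoint_one_sub_smul {ρ : B →⋆ₙₐ[ℂ] C} {u : B} (hu : IsCutoff ρ u) (t : ℝ) :
    IsSelfAdjoint (1 - (t : ℂ) • (u : Unitization ℂ B)) := by
  rw [isSelfAdjoint_iff, star_sub, star_one, star_smul, ← Unitization.inr_star,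
    hu.isSelfAdjoint.star_eq]
  simp

lemma IsCutoff.norm_one_sub_smul_le {ρ : B →⋆ₙₐ[ℂ] C} {u : B} (hu : IsCutoff ρ u) {t : ℝ}
    (ht₀ : 0 ≤ t) (ht₁ : t ≤ 1) : ‖1 - (t : ℂ) • (u : Unitization ℂ B)‖ ≤ 1 := by
  have e : 1 - (t : ℂ) • (u : Unitization ℂ B) =
      ((1 - t : ℝ) : ℂ) • 1 + (t : ℂ) • (1 - (u : Unitization ℂ B)) := by
    rw [smul_sub, Complex.ofReal_sub, sub_smul, Complex.ofReal_one, one_smul]; abel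
  rw [e]
  refine (norm_add_le _ _).trans ?_
  rw [norm_smul, norm_smul, Complex.norm_real, Complex.norm_real, Real.norm_of_nonneg ht₀,
    Real.norm_of_nonneg (sub_nonneg.mpr ht₁), norm_one]
  nlinarith [hu.norm_one_sub_le]

/-- A lift whose product `h k` exceeds the bound by `δ` can be moved by `O(δ)`, inside the fibre
of `ρ`, to one where the excess is halved. -/
lemma exists_contractive_halve_excess (ρ : B →⋆ₙₐ[ℂ] C) {ε δ : ℝ} (hε : 0 < ε) (hδ : 0 < δ)
    {h k x : B} (H : Contractive h k x) (hρ : ‖ρ (h * k)‖ ≤ ε) (hhk : ‖h * k‖ ≤ ε + δ) :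
    ∃ h' k' x' : B, Contractive h' k' x' ∧ ρ h' = ρ h ∧ ρ k' = ρ k ∧ ρ x' = ρ x ∧
      ‖h' * k'‖ ≤ ε + δ / 2 ∧ ‖h' - h‖ ≤ 6 / ε * δ ∧ ‖k' - k‖ ≤ 6 / ε * δ ∧
      ‖x' - x‖ ≤ 6 / ε * δ := by
  obtain ⟨hh, hk⟩ := H.isSelfAdjoint
  obtain ⟨nh, nk, nx⟩ := H.norm_le_one
  -- This makes `(1 - t) * (ε + δ) ≤ ε`, so a single factor `1 - t` already absorbs the excess,
  -- while `t` remains `O(δ)`.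
  set t : ℝ := 2 * δ / (ε + 2 * δ) with ht
  have ht₀ : 0 ≤ t := by positivity
  have ht₁ : t ≤ 1 := by rw [ht, div_le_one (by positivity)]; linarith
  have hs : 1 - t = ε / (ε + 2 * δ) := by rw [ht]; field_simp; ring
  have htδ : 3 * t ≤ 6 / ε * δ := by
    have : t ≤ 2 * δ / ε := by rw [ht]; gcongr; linarith
    calc 3 * t ≤ 3 * (2 * δ / ε) := by gcongr
      _ = _ := by ring
  -- An excess of `δ / 4` away from `w` keeps a strict margin below the target `δ / 2`.
  obtain ⟨w, hw, hw'⟩ := exists_isCutoff_norm_mul_one_sub_le ρ hε.le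
    (show ε < ε + δ / 4 by linarith) hρ
  have hex : ∀ m : ℕ, ∃ u, IsCutoff ρ u ∧ ‖w * u - w‖ < 1 / ((m : ℝ) + 1) ∧
      ‖h * u - u * h‖ < 1 / ((m : ℝ) + 1) ∧ ‖k * u - u * k‖ < 1 / ((m : ℝ) + 1) := by
    classical
    intro m
    obtain ⟨u, hu, huw, huS⟩ := exists_isCutoff_quasicentral ρ {w} {h, k}
      (by simpa using hw.map_eq_zero) (by simpa using ⟨hh, hk⟩)
      (by positivity : (0 : ℝ) < 1 / ((m : ℝ) + 1))
    exact ⟨u, hu, huw w (by simp), huS h (by simp), huS k (by simp)⟩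
  choose u hu huw huh huk using hex
  have hlim : ∀ a : ℕ → B, (∀ m, ‖a m‖ ≤ 1 / ((m : ℝ) + 1)) →
      Tendsto (fun m => (t : ℂ) • (a m : Unitization ℂ B)) atTop (𝓝 0) := by
    intro a ha
    have : Tendsto (fun m => (a m : Unitization ℂ B)) atTop (𝓝 0) :=
      squeeze_zero_norm (fun m => (Unitization.norm_inr (a m)).trans_le (ha m))
        tendsto_one_div_add_atTop_nhds_zero_nat
    simpa using this.const_smul (t : ℂ)
  have hcomm : ∀ a : B, (∀ m, ‖a * u m - u m * a‖ < 1 / ((m : ℝ) + 1)) →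
      Tendsto (fun m => (1 - (t : ℂ) • (u m : Unitization ℂ B)) * a -
        a * (1 - (t : ℂ) • (u m : Unitization ℂ B))) atTop (𝓝 0) := by
    intro a ha
    refine (hlim _ fun m => (ha m).le).congr fun m => ?_
    rw [Unitization.inr_sub, Unitization.inr_mul, Unitization.inr_mul, sub_mul, mul_sub,
      smul_mul_assoc, mul_smul_comm, smul_sub, one_mul, mul_one]
    abel
  have hfw : Tendsto (fun m => (1 - (t : ℂ) • (u m : Unitization ℂ B)) * w -
      algebraMap ℂ (Unitization ℂ B) ((1 - t : ℝ) : ℂ) * w) atTop (𝓝 0) := by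
    refine (hlim (fun m => w - u m * w) fun m => ?_).congr fun m => ?_
    · refine le_trans (le_of_eq ?_) (huw m).le
      rw [← norm_star, star_sub, star_mul, hw.isSelfAdjoint.star_eq,
        (hu m).isSelfAdjoint.star_eq, norm_sub_rev]
    · rw [Unitization.inr_sub, Unitization.inr_mul, sub_mul, smul_mul_assoc, smul_sub, one_mul,
        ← Algebra.smul_def, Complex.ofReal_sub, sub_smul, Complex.ofReal_one, one_smul]
      abel
  have hs₀ : 0 ≤ 1 - t := sub_nonneg.mpr ht₁
  have hr' : (1 - t) ^ 4 * ‖(h : Unitization ℂ B) * k‖ < ε + δ / 2 := by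
    rw [← Unitization.inr_mul, Unitization.norm_inr]
    have h₁ : (1 - t) ^ 4 ≤ 1 - t := pow_le_of_le_one hs₀ (by linarith) (by norm_num)
    calc (1 - t) ^ 4 * ‖h * k‖ ≤ (1 - t) * (ε + δ) := by gcongr
      _ ≤ ε := by
        rw [hs, div_mul_eq_mul_div, div_le_iff₀ (by positivity)]
        gcongr; linarith
      _ < _ := by linarith
  have hinr : ∀ {a : B}, IsSelfAdjoint a → IsSelfAdjoint (a : Unitization ℂ B) := fun ha =>
    ha.map (Unitization.inrNonUnitalStarAlgHom ℂ B)
  obtain ⟨m, hm⟩ := (eventually_norm_compressed_product_lt (hinr hh) (hinr hk)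
    ((Unitization.norm_inr w).trans_le hw.norm_le)
    (fun m => (hu m).isSelfAdjoint_one_sub_smul t) (fun m => (hu m).norm_one_sub_smul_le ht₀ ht₁)
    (hcomm h huh) (hcomm k huk) hs₀ hfw (by rwa [← Unitization.inr_mul])
    (by linarith : ε + δ / 4 < ε + δ / 2) hr').exists
  refine ⟨squeeze t (u m) h, squeeze t (u m) k, squeeze t (u m) x,
    H.compress ((hu m).isSelfAdjoint_one_sub_smul t) ((hu m).norm_one_sub_smul_le ht₀ ht₁)
      (inr_squeeze _ _ _) (inr_squeeze _ _ _) (inr_squeeze _ _ _),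
    (hu m).map_squeeze _ _, (hu m).map_squeeze _ _, (hu m).map_squeeze _ _, ?_,
    (norm_squeeze_sub_le ht₀ ht₁ (hu m).norm_le nh).trans htδ,
    (norm_squeeze_sub_le ht₀ ht₁ (hu m).norm_le nk).trans htδ,
    (norm_squeeze_sub_le ht₀ ht₁ (hu m).norm_le nx).trans htδ⟩
  rw [← Unitization.norm_inr (𝕜 := ℂ), Unitization.inr_mul, inr_squeeze, inr_squeeze]
  exact hm.le

/-- The relations lift along surjections. -/
theorem exists_relations_lift (ρ : B →⋆ₙₐ[ℂ] C) (hρ : Function.Surjective ρ) {ε : ℝ}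
    (hε : 0 < ε) {a b c : C} (H : Relations ε a b c) :
    ∃ h k x : B, Relations ε h k x ∧ ρ h = a ∧ ρ k = b ∧ ρ x = c := by
  obtain ⟨hab, H⟩ := relations_iff.mp H
  obtain ⟨ha, hb⟩ := H.isSelfAdjoint
  have hlift : ∀ {a : C}, IsSelfAdjoint a → ∃ h : B, IsSelfAdjoint h ∧ ρ h = a := by
    intro a ha
    obtain ⟨h, rfl⟩ := hρ a
    refine ⟨(2⁻¹ : ℝ) • (h + star h), (IsSelfAdjoint.all (2⁻¹ : ℝ)).smul (.add_star_self h), ?_⟩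
    have e : ρ ((2⁻¹ : ℝ) • (h + star h)) = (2⁻¹ : ℝ) • ρ (h + star h) := by
      rw [← Complex.coe_smul, ← Complex.coe_smul, map_smul]
    rw [e, map_add, map_star, ha.star_eq, ← two_smul ℝ (ρ h), smul_smul]
    norm_num
  obtain ⟨h₀, hh₀, rfl⟩ := hlift ha
  obtain ⟨k₀, hk₀, rfl⟩ := hlift hb
  obtain ⟨x₀, rfl⟩ := hρ c
  obtain ⟨h₁, k₁, x₁, H₁, hρ₁⟩ := exists_contractive_map_eq x₀ hh₀ hk₀
  obtain ⟨e₁, e₂, e₃⟩ := hρ₁ C ρ H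
  rw [← e₁, ← e₂] at hab
  rw [← e₁, ← e₂, ← e₃]
  let T := {p : B × B × B // Contractive p.1 p.2.1 p.2.2 ∧ ρ p.1 = ρ h₁ ∧ ρ p.2.1 = ρ k₁ ∧
    ρ p.2.2 = ρ x₁}
  have step : ∀ (n : ℕ) (p : T), ‖p.1.1 * p.1.2.1‖ ≤ ε + (1 / 2) ^ n → ∃ q : T,
      ‖q.1.1 * q.1.2.1‖ ≤ ε + (1 / 2) ^ (n + 1) ∧ ‖q.1.1 - p.1.1‖ ≤ 6 / ε * (1 / 2) ^ n ∧
      ‖q.1.2.1 - p.1.2.1‖ ≤ 6 / ε * (1 / 2) ^ n ∧ ‖q.1.2.2 - p.1.2.2‖ ≤ 6 / ε * (1 / 2) ^ n := by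
    rintro n ⟨⟨h, k, x⟩, H, r₁, r₂, r₃⟩ hp
    obtain ⟨h', k', x', H', s₁, s₂, s₃, hn, d₁, d₂, d₃⟩ :=
      exists_contractive_halve_excess ρ hε (by positivity : (0 : ℝ) < (1 / 2) ^ n) H
        (by rw [map_mul, r₁, r₂]; exact hab) hp
    exact ⟨⟨⟨h', k', x'⟩, H', s₁.trans r₁, s₂.trans r₂, s₃.trans r₃⟩,
      hn.trans (by rw [pow_succ]; linarith), d₁, d₂, d₃⟩
  choose! next hnext using step
  -- The iteration can start with excess `1` because `h₁` and `k₁` are contractions.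
  have h0 : ‖h₁ * k₁‖ ≤ ε + (1 / 2) ^ 0 := by
    obtain ⟨n₁, n₂, -⟩ := H₁.norm_le_one
    have := (norm_mul_le h₁ k₁).trans (mul_le_one₀ n₁ (norm_nonneg _) n₂)
    rw [pow_zero]; linarith
  let s : ℕ → T := fun n => Nat.rec ⟨⟨h₁, k₁, x₁⟩, H₁, rfl, rfl, rfl⟩ next n
  have hs : ∀ n, ‖(s n).1.1 * (s n).1.2.1‖ ≤ ε + (1 / 2) ^ n := by
    intro n
    induction n with
    | zero => exact h0
    | succ n ih => exact (hnext n (s n) ih).1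
  have hlim : ∀ g : ℕ → B, (∀ n, ‖g (n + 1) - g n‖ ≤ 6 / ε * (1 / 2) ^ n) →
      ∃ l, Tendsto g atTop (𝓝 l) := by
    intro g hg
    refine cauchySeq_tendsto_of_complete (cauchySeq_of_le_geometric (1 / 2) (6 / ε) (by norm_num)
      fun n => ?_)
    rw [dist_comm, dist_eq_norm]
    exact hg n
  obtain ⟨h, hh⟩ := hlim (fun n => (s n).1.1) fun n => (hnext n (s n) (hs n)).2.1
  obtain ⟨k, hk⟩ := hlim (fun n => (s n).1.2.1) fun n => (hnext n (s n) (hs n)).2.2.1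
  obtain ⟨x, hx⟩ := hlim (fun n => (s n).1.2.2) fun n => (hnext n (s n) (hs n)).2.2.2
  have hc := map_continuous ρ
  refine ⟨h, k, x, relations_iff.mpr ⟨?_, .of_tendsto hh hk hx fun n => (s n).2.1⟩, ?_, ?_, ?_⟩
  · have hp : Tendsto (fun n : ℕ => ε + (1 / 2 : ℝ) ^ n) atTop (𝓝 ε) := by
      simpa using (tendsto_pow_atTop_nhds_zero_of_lt_one (by norm_num : (0 : ℝ) ≤ 1 / 2)
        (by norm_num)).const_add ε
    exact le_of_tendsto_of_tendsto' (hh.mul hk).norm hp hs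
  · exact tendsto_nhds_unique ((hc.tendsto h).comp hh)
      (tendsto_const_nhds.congr fun n => (s n).2.2.1.symm)
  · exact tendsto_nhds_unique ((hc.tendsto k).comp hk)
      (tendsto_const_nhds.congr fun n => (s n).2.2.2.1.symm)
  · exact tendsto_nhds_unique ((hc.tendsto x).comp hx)
      (tendsto_const_nhds.congr fun n => (s n).2.2.2.2.symm)

end Lift

lemma Relations.map {ε : ℝ} {A B : Type*} [NonUnitalCStarAlgebra A] [NonUnitalCStarAlgebra B]
    {h k x : A} (H : Relations ε h k x) (φ : A →⋆ₙₐ[ℂ] B) :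
    Relations ε (φ h) (φ k) (φ x) := by
  obtain ⟨hn, H⟩ := relations_iff.mp H
  refine relations_iff.mpr ⟨?_, H.map φ⟩
  rw [← map_mul]
  exact (NonUnitalStarAlgHom.norm_apply_le φ _).trans hn

theorem IsUniversal.isProjective {ε : ℝ} (hε : 0 < ε) {P : Type v} [NonUnitalCStarAlgebra P]
    {h k x : P} (H : IsUniversal.{u, v} ε h k x) : IsProjective.{u, v} P := by
  intro B C _ _ ρ hρ φ
  have hφ : Relations ε (φ h) (φ k) (φ x) := H.1.map φ
  obtain ⟨h', k', x', hB, e₁, e₂, e₃⟩ := exists_relations_lift ρ hρ hε hφ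
  obtain ⟨ψ, ⟨f₁, f₂, f₃⟩, -⟩ := H.2 B h' k' x' hB
  refine ⟨ψ, (H.2 C _ _ _ hφ).unique ⟨?_, ?_, ?_⟩ ⟨rfl, rfl, rfl⟩⟩
  · rw [NonUnitalStarAlgHom.comp_apply, f₁, e₁]
  · rw [NonUnitalStarAlgHom.comp_apply, f₂, e₂]
  · rw [NonUnitalStarAlgHom.comp_apply, f₃, e₃]

/-! ### Relations detected by families of homomorphisms -/

section JointlyInjective

/-- The clamped triple has the same image as the original one under each `φ i`, so the two coincide.
No description of the order on matrices over a product is needed. -/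
lemma Contractive.of_jointly_injective {A : Type*} [NonUnitalCStarAlgebra A] {ι : Type*}
    {B : ι → Type v} [∀ i, NonUnitalCStarAlgebra (B i)] (φ : ∀ i, A →⋆ₙₐ[ℂ] B i)
    (hφ : ∀ a b : A, (∀ i, φ i a = φ i b) → a = b) {h k x : A}
    (H : ∀ i, Contractive (φ i h) (φ i k) (φ i x)) : Contractive h k x := by
  have hh : IsSelfAdjoint h := hφ _ _ fun i => by rw [map_star, (H i).isSelfAdjoint.1.star_eq]
  have hk : IsSelfAdjoint k := hφ _ _ fun i => by rw [map_star, (H i).isSelfAdjoint.2.star_eq]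
  obtain ⟨h', k', x', H', e⟩ := exists_contractive_map_eq.{v} x hh hk
  rwa [hφ h' h fun i => (e _ (φ i) (H i)).1, hφ k' k fun i => (e _ (φ i) (H i)).2.1,
    hφ x' x fun i => (e _ (φ i) (H i)).2.2] at H'

lemma Relations.of_injective {A : Type u} {B : Type v} [NonUnitalCStarAlgebra A]
    [NonUnitalCStarAlgebra B] (φ : A →⋆ₙₐ[ℂ] B) (hφ : Function.Injective φ) {ε : ℝ} {h k x : A}
    (H : Relations ε (φ h) (φ k) (φ x)) : Relations ε h k x := by
  obtain ⟨hn, H⟩ := relations_iff.mp H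
  refine relations_iff.mpr ⟨?_, .of_jointly_injective (ι := Unit) (fun _ => φ)
    (fun a b hab => hφ (hab ())) fun _ => H⟩
  rwa [← NonUnitalStarAlgHom.norm_map φ hφ, map_mul]

end JointlyInjective

/-! ### Generated C⋆-subalgebras and their size -/

section Generated

variable {A : Type*} [NonUnitalCStarAlgebra A]

/-- The C⋆-subalgebra that a set generates. -/
def generated (s : Set A) : NonUnitalStarSubalgebra ℂ A :=
  (NonUnitalStarAlgebra.adjoin ℂ s).topologicalClosure

lemma isClosed_generated (s : Set A) : IsClosed (generated s : Set A) :=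
  NonUnitalStarSubalgebra.isClosed_topologicalClosure _

lemma subset_generated (s : Set A) : s ⊆ generated s :=
  (NonUnitalStarAlgebra.subset_adjoin ℂ s).trans
    (NonUnitalStarSubalgebra.le_topologicalClosure _)

noncomputable instance (s : Set A) : NonUnitalCStarAlgebra (generated s) :=
  NonUnitalStarSubalgebra.nonUnitalCStarAlgebra _ (h_closed := isClosed_generated s)

/-- ⋆-homomorphisms on a generated C⋆-subalgebra are determined by the generators. -/
lemma generated_hom_ext {B : Type*} [NonUnitalCStarAlgebra B] {s : Set A}
    {φ ψ : generated s →⋆ₙₐ[ℂ] B}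
    (h : ∀ (a : A) (ha : a ∈ s), φ ⟨a, subset_generated s ha⟩ = ψ ⟨a, subset_generated s ha⟩) :
    φ = ψ := by
  -- The equalizer is pushed into `A`, where minimality of the closure applies.
  let D : NonUnitalStarSubalgebra ℂ A :=
    (NonUnitalStarAlgHom.equalizer φ ψ).map (NonUnitalStarSubalgebraClass.subtype (generated s))
  have hDmem : ∀ a, a ∈ D ↔ ∃ b : generated s, φ b = ψ b ∧ (b : A) = a := fun a => Iff.rfl
  have hD : IsClosed (D : Set A) := by
    have e : (D : Set A) = Subtype.val '' {b : generated s | φ b = ψ b} := by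
      ext a; exact hDmem a
    rw [e]
    exact (isClosed_generated s).isClosedEmbedding_subtypeVal.isClosedMap _
      (isClosed_eq (map_continuous φ) (map_continuous ψ))
  have hle : generated s ≤ D := by
    refine NonUnitalStarSubalgebra.topologicalClosure_minimal _ ?_ hD
    refine NonUnitalStarAlgebra.adjoin_le fun a ha => ?_
    exact (hDmem a).mpr ⟨⟨a, subset_generated s ha⟩, h a ha, rfl⟩
  ext b
  obtain ⟨b', hb', e⟩ := (hDmem _).mp (hle b.2)
  rwa [Subtype.ext e] at hb'

lemma countable_closure_subsemigroup {M : Type*} [Semigroup M] {s : Set M} (hs : s.Countable) :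
    (Subsemigroup.closure s : Set M).Countable := by
  have : Countable s := hs
  have hF : Countable (FreeSemigroup s) := by
    refine Function.Injective.countable (f := fun w : FreeSemigroup s => (w.head, w.tail)) ?_
    rintro ⟨a, l⟩ ⟨b, m⟩ h
    simpa using h
  have hle : Subsemigroup.closure s ≤ (FreeSemigroup.lift (Subtype.val : s → M)).srange := by
    rw [Subsemigroup.closure_le]
    exact fun a ha => ⟨FreeSemigroup.of ⟨a, ha⟩, by simp⟩
  exact (Set.countable_range (FreeSemigroup.lift (Subtype.val : s → M))).mono hle

/-- The words in `s ∪ star s` are countable and span a dense subspace. -/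
lemma separableSpace_generated {s : Set A} (hs : s.Countable) :
    TopologicalSpace.SeparableSpace (generated s) := by
  refine TopologicalSpace.IsSeparable.separableSpace (s := (generated s : Set A)) ?_
  refine TopologicalSpace.IsSeparable.closure ?_
  have hc : (s ∪ star s).Countable := hs.union (by
    have : star s = star '' s := by simp
    rw [this]; exact hs.image _)
  have := (countable_closure_subsemigroup hc).isSeparable.span (R := ℂ)
  rwa [← NonUnitalStarAlgebra.adjoin_eq_span] at this

/-- A point is determined by its distances to a dense sequence. `ULift` places the target in
whichever universe is wanted. -/
lemma exists_injective_of_separableSpace (X : Type*) [MetricSpace X]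
    [TopologicalSpace.SeparableSpace X] : ∃ f : X → ULift.{v} (ℕ → ℝ), Function.Injective f := by
  rcases isEmpty_or_nonempty X with hX | hX
  · exact ⟨fun _ => ⟨0⟩, fun a => (hX.false a).elim⟩
  refine ⟨fun a => ⟨fun n => dist a (TopologicalSpace.denseSeq X n)⟩, fun a b hab => ?_⟩
  have h : ∀ n, dist a (TopologicalSpace.denseSeq X n) = dist b (TopologicalSpace.denseSeq X n) :=
    fun n => congrFun (ULift.up_injective hab) n
  have h' : (fun c => dist a c) = fun c => dist b c :=
    (TopologicalSpace.denseRange_denseSeq X).equalizer (by fun_prop) (by fun_prop) (funext h)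
  have := congrFun h' b
  simpa using this

end Generated

/-! ### Transport of structure -/

section Transfer

variable {S A : Type*} [NonUnitalCStarAlgebra A]

/-- The C⋆-algebra structure transported along a bijection. -/
@[reducible]
noncomputable def transferCStarAlgebra (e : S ≃ A) : NonUnitalCStarAlgebra S :=
  letI r : NonUnitalRing S := e.nonUnitalRing
  letI : Star S := e.star
  letI : SMul ℂ S := e.smul ℂ
  have hadd (x y : S) : e (x + y) = e x + e y := e.apply_symm_apply _
  have hmul (x y : S) : e (x * y) = e x * e y := e.apply_symm_apply _
  have hstar (x : S) : e (star x) = star (e x) := e.apply_symm_apply _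
  have hsmul (c : ℂ) (x : S) : e (c • x) = c • e x := e.apply_symm_apply _
  letI n : NonUnitalNormedRing S := NonUnitalNormedRing.induced S A
    ({ toFun := e, map_add' := hadd, map_mul' := hmul, map_zero' := e.apply_symm_apply _ } :
      S →ₙ+* A) e.injective
  have hnorm (x : S) : ‖x‖ = ‖e x‖ := rfl
  letI m : Module ℂ S := e.injective.module ℂ
    ({ toFun := e, map_add' := hadd, map_zero' := e.apply_symm_apply _ } : S →+ A) hsmul
  { n with
    star := star
    star_involutive := fun x => e.injective (by rw [hstar, hstar, star_star])
    star_mul := fun x y => e.injective (by rw [hstar, hmul, hmul, hstar, hstar, star_mul])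
    star_add := fun x y => e.injective (by rw [hstar, hadd, hadd, hstar, hstar, star_add])
    complete := by
      have hi : IsUniformInducing e := ⟨rfl⟩
      have := (hi.completeSpace_congr e.surjective).mpr inferInstance
      exact fun {_} hf => this.complete hf
    norm_mul_self_le := fun x => by
      rw [hnorm, hnorm, hmul, hstar, CStarRing.norm_star_mul_self]
    toModule := m
    norm_smul_le := fun c x => by
      rw [hnorm, hnorm, hsmul, norm_smul]
    smul_assoc := fun c x y => e.injective (by
      rw [smul_eq_mul, smul_eq_mul, hmul, hsmul, hsmul, hmul, smul_mul_assoc])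
    smul_comm := fun c x y => e.injective (by
      rw [smul_eq_mul, smul_eq_mul, hmul, hsmul, hsmul, hmul, mul_smul_comm])
    star_smul := fun c x => e.injective (by
      rw [hstar, hsmul, hsmul, hstar, star_smul]) }

/-- The ⋆-homomorphism underlying the transport of a C⋆-algebra structure. -/
noncomputable def transferHom (e : S ≃ A) :
    letI := transferCStarAlgebra e
    S →⋆ₙₐ[ℂ] A :=
  letI := transferCStarAlgebra e
  { toFun := e
    map_smul' := fun _ _ => e.apply_symm_apply _
    map_zero' := e.apply_symm_apply _
    map_add' := fun _ _ => e.apply_symm_apply _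
    map_mul' := fun _ _ => e.apply_symm_apply _
    map_star' := fun _ => e.apply_symm_apply _ }

end Transfer

/-! ### Construction of the universal algebra -/

section Universal

/-- A triple with the relations in a C⋆-algebra on a subset of a fixed set. Up to isomorphism every
C⋆-algebra that is generated by such a triple occurs. -/
structure Model (ε : ℝ) : Type v where
  carrier : Set (ULift.{v} (ℕ → ℝ))
  [str : NonUnitalCStarAlgebra carrier]
  h : carrier
  k : carrier
  x : carrier
  rel : Relations ε h k x

attribute [instance] Model.str

/-- The product of all models. -/
abbrev Models (ε : ℝ) : Type v := lp (fun j : Model.{v} ε => j.carrier) ∞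

/-- The projection of the product of all models onto one of them. -/
def Models.eval {ε : ℝ} (j : Model.{v} ε) : Models.{v} ε →⋆ₙₐ[ℂ] j.carrier where
  toFun f := f j
  map_smul' _ _ := rfl
  map_zero' := rfl
  map_add' _ _ := rfl
  map_mul' _ _ := rfl
  map_star' _ := rfl

lemma memℓp_of_norm_le_one {ι : Type*} {E : ι → Type*} [∀ i, NormedAddCommGroup (E i)]
    {f : ∀ i, E i} (hf : ∀ i, ‖f i‖ ≤ 1) : Memℓp f ∞ :=
  memℓp_infty ⟨1, by rintro _ ⟨i, rfl⟩; exact hf i⟩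

/-- The universal generator `h`. -/
def genH (ε : ℝ) : Models.{v} ε :=
  ⟨fun j => j.h, memℓp_of_norm_le_one fun j => (relations_iff.mp j.rel).2.norm_le_one.1⟩

/-- The universal generator `k`. -/
def genK (ε : ℝ) : Models.{v} ε :=
  ⟨fun j => j.k, memℓp_of_norm_le_one fun j => (relations_iff.mp j.rel).2.norm_le_one.2.1⟩

/-- The universal generator `x`. -/
def genX (ε : ℝ) : Models.{v} ε :=
  ⟨fun j => j.x, memℓp_of_norm_le_one fun j => (relations_iff.mp j.rel).2.norm_le_one.2.2⟩

lemma relations_gen (ε : ℝ) (hε : 0 ≤ ε) : Relations ε (genH.{v} ε) (genK ε) (genX ε) := by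
  refine relations_iff.mpr ⟨?_, ?_⟩
  · exact lp.norm_le_of_forall_le hε fun j => (relations_iff.mp j.rel).1
  · refine .of_jointly_injective (fun j => Models.eval j) (fun a b h => ?_) fun j =>
      (relations_iff.mp j.rel).2
    exact lp.ext (funext h)

/-- Every triple with the relations is the image of a model. -/
lemma exists_model {ε : ℝ} {A : Type u} [NonUnitalCStarAlgebra A] {a b c : A}
    (H : Relations ε a b c) :
    ∃ (j : Model.{v} ε) (φ : j.carrier →⋆ₙₐ[ℂ] A), φ j.h = a ∧ φ j.k = b ∧ φ j.x = c := by
  let s : Set A := {a, b, c}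
  have hs : s.Countable := (Set.toFinite _).countable
  have := separableSpace_generated hs
  obtain ⟨f, hf⟩ := exists_injective_of_separableSpace.{v} (generated s)
  let e : Set.range f ≃ generated s := (Equiv.ofInjective f hf).symm
  let _ : NonUnitalCStarAlgebra (Set.range f) := transferCStarAlgebra e
  let φ : Set.range f →⋆ₙₐ[ℂ] A :=
    (NonUnitalStarSubalgebraClass.subtype (generated s)).comp (transferHom e)
  have hφ : Function.Injective φ := Subtype.val_injective.comp e.injective
  have hφe : ∀ (d : A) (hd : d ∈ s), φ (e.symm ⟨d, subset_generated s hd⟩) = d := fun d hd =>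
    congrArg Subtype.val (e.apply_symm_apply _)
  have ha := hφe a (by simp [s])
  have hb := hφe b (by simp [s])
  have hc := hφe c (by simp [s])
  exact ⟨⟨Set.range f, _, _, _, .of_injective φ hφ (by rw [ha, hb, hc]; exact H)⟩, φ, ha, hb, hc⟩

theorem exists_isUniversal (ε : ℝ) (hε : 0 ≤ ε) :
    ∃ (P : Type v) (_ : NonUnitalCStarAlgebra P) (h k x : P), IsUniversal.{u, v} ε h k x := by
  let s : Set (Models.{v} ε) := {genH ε, genK ε, genX ε}
  have m₁ : genH ε ∈ s := by simp [s]
  have m₂ : genK ε ∈ s := by simp [s]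
  have m₃ : genX ε ∈ s := by simp [s]
  let ι : generated s →⋆ₙₐ[ℂ] Models.{v} ε := NonUnitalStarSubalgebraClass.subtype (generated s)
  refine ⟨generated s, inferInstance, ⟨_, subset_generated s m₁⟩, ⟨_, subset_generated s m₂⟩,
    ⟨_, subset_generated s m₃⟩, .of_injective ι Subtype.val_injective (relations_gen ε hε),
    fun A _ a b c H => ?_⟩
  obtain ⟨j, φ, ha, hb, hc⟩ := exists_model.{u, v} H
  -- Existence is evaluation at the coordinate that models the given triple; uniqueness holds
  -- because the generators generate.
  refine ⟨φ.comp ((Models.eval j).comp ι), ⟨ha, hb, hc⟩, ?_⟩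
  rintro ψ ⟨ha', hb', hc'⟩
  refine generated_hom_ext fun d hd => ?_
  rcases hd with rfl | rfl | rfl
  · exact ha'.trans ha.symm
  · exact hb'.trans hb.symm
  · exact hc'.trans hc.symm

end Universal

end SoftQC

/-- The universal C⋆-algebra of the relations exists, and it is projective. -/
theorem theorem4p3 (ε : ℝ) (hε : 0 < ε) :
    (∃ (P : Type v) (_ : NonUnitalCStarAlgebra P) (h k x : P),
        SoftQC.IsUniversal.{u, v} ε h k x) ∧
      ∀ (P : Type v) [NonUnitalCStarAlgebra P] (h k x : P),
        SoftQC.IsUniversal.{u, v} ε h k x → SoftQC.IsProjective.{u, v} P :=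
  ⟨SoftQC.exists_isUniversal.{u, v} ε hε.le, fun _ _ _ _ _ H => H.isProjective hε⟩
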